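/- Let $\mathcal A$ be an at most countable set of agents, $\mathcal G$ an at most countable set of nonempty subsets of $\mathcal A$, and $[0,1]_{\mathbb Q}=[0,1]\cap\mathbb Q$. **Language.** Terms and atomic formulas are built as in first-order logic (without equality) from countably many variables and from function symbols $f^m_k$ and relation symbols $R^m_k$ of every arity $m\ge 0$, $k\in\mathbb N$. Formulas are closed under $\neg,\wedge,\forall x$ and the operators $K_i$, $E_G$, $C_G$, $P_{i,\ge r}$, $E_G^r$, $C_G^r$ ($i\in\mathcal A$, $G\in\mathcal G$, $r\in[0,1]_{\mathbb Q}$). The connectives $\to,\vee,\bot,\top$ are the usual abbreviations, and $P_{i,<r}\varphi:=\neg P_{i,\ge r}\varphi$, $P_{i,\le r}\varphi:=P_{i,\ge 1-r}\neg\varphi$, $K_i^r\varphi:=K_iP_{i,\ge r}\varphi$, $(E_G)^1\varphi:=E_G\varphi$, $(E_G)^{m+1}\varphi:=E_G(E_G)^m\varphi$, $(F_G^r)^0\varphi:=\top$, $(F_G^r)^{m+1}\varphi:=E_G^r(\varphi\wedge(F_G^r)^m\varphi)$. For $k\in\mathbb N$, formulas $\theta_0,\dots,\theta_k$ and operators $X_1,\dots,X_k\in\{K_i,P_{i,\ge1}\mid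 i\in\mathcal A\}$ put $\Phi_0(\tau)=\theta_0\to\tau$ and $\Phi_{j}(\tau)=\theta_j\to X_j\Phi_{j-1}(\tau)$ for $1\le j\le k$. A sentence is a formula without free variables; a theory is a set of sentences. **Models.** A model $M=(S,D,I,\mathcal K,\mathcal P)$ consists of a nonempty set $S$ of states, a nonempty domain $D$, an interpretation of the function symbols by functions on $D$ (the same in all states), for every state an interpretation of the relation symbols by relations on $D$, for every agent $i$ a binary relation $\mathcal K_i$ on $S$ (with $\mathcal K_i(s)=\{t\mid (s,t)\in\mathcal K_i\}$), and for every agent $i$ and state $s$ a triple $\mathcal P(i,s)=(S_{i,s},\chi_{i,s},\mu_{i,s})$, where $\emptyset\ne S_{i,s}\subseteq S$, $\chi_{i,s}$ is an algebra of subsets of $S_{i,s}$, and $\mu_{i,s}:\chi_{i,s}\to[0,1]$ is finitely additive with $\mu_{i,s}(S_{i,s})=1$. Satisfaction $(M,s,v)\models\varphi$ under a valuation $v$ is defined as usual for atomic formulas, $\neg$, $\wedge$, $\forall$, and by: $(M,s,v)\models K_i\varphi$ iff $(M,t,v)\models\varphi$ for all $t\in\mathcal K_i(s)$; $E_G\varphi$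 iff $K_i\varphi$ for all $i\in G$; $C_G\varphi$ iff $(E_G)^m\varphi$ for all $m\ge1$; $P_{i,\ge r}\varphi$ iff $\mu_{i,s}(\{t\in S_{i,s}\mid (M,t,v)\models\varphi\})\ge r$; $E_G^r\varphi$ iff $K_i^r\varphi$ for all $i\in G$; $C_G^r\varphi$ iff $(F_G^r)^m\varphi$ for all $m\ge0$. Let $\mathcal M^{MEAS,CON}_{\mathcal A}$ be the class of models such that all sets $\{t\in S_{i,s}\mid (M,t,v)\models\varphi\}$ belong to $\chi_{i,s}$ and $S_{i,s}\subseteq\mathcal K_i(s)$ for all $i$ and $s$. **The axiomatization $Ax^{CON}_{PCK^{fo}}$.** Axiom schemata: all instances of propositional tautologies; $\forall x(\varphi\to\psi)\to(\varphi\to\forall x\psi)$ for $x$ not free in $\varphi$; $\forall x\varphi(x)\to\varphi(t)$ for $t$ free for $x$ in $\varphi$; $\forall xK_i\varphi\to K_i\forall x\varphi$; $(K_i\varphi\wedge K_i(\varphi\to\psi))\to K_i\psi$; $E_G\varphi\to K_i\varphi$ for $i\in G$; $C_G\varphi\to(E_G)^m\varphi$ for $m\ge1$; $P_{i,\ge0}\varphi$;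 $P_{i,\le r}\varphi\to P_{i,<t}\varphi$ for $t>r$; $P_{i,<t}\varphi\to P_{i,\le t}\varphi$; $(P_{i,\ge r}\varphi\wedge P_{i,\ge t}\psi\wedge P_{i,\ge1}\neg(\varphi\wedge\psi))\to P_{i,\ge\min(1,r+t)}(\varphi\vee\psi)$; $(P_{i,\le r}\varphi\wedge P_{i,<t}\psi)\to P_{i,<r+t}(\varphi\vee\psi)$ for $r+t\le1$; $E_G^r\varphi\to K_i^r\varphi$ for $i\in G$; $C_G^r\varphi\to(F_G^r)^m\varphi$ for $m\ge0$; and the consistency axiom $K_i\varphi\to P_{i,\ge1}\varphi$. Rules: modus ponens; from $\varphi$ infer $\forall x\varphi$; from a theorem $\varphi$ infer $K_i\varphi$; and, for every nested implication $\Phi_k$, from $\{\Phi_k(K_i\varphi)\mid i\in G\}$ infer $\Phi_k(E_G\varphi)$; from $\{\Phi_k((E_G)^m\varphi)\mid m\ge1\}$ infer $\Phi_k(C_G\varphi)$; from $\{\Phi_k(P_{i,\ge r-1/m}\varphi)\mid m\in\mathbb N,\ m\ge 1/r\}$ infer $\Phi_k(P_{i,\ge r}\varphi)$ for $r\in(0,1]_{\mathbb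 Q}$; from $\{\Phi_k(K_i^r\varphi)\mid i\in G\}$ infer $\Phi_k(E_G^r\varphi)$; from $\{\Phi_k((F_G^r)^m\varphi)\mid m\ge0\}$ infer $\Phi_k(C_G^r\varphi)$. (There is no necessitation rule for $P_{i,\ge1}$.) $T\vdash\varphi$ means that $\varphi$ has a proof from $T$, where proofs are at most countable well-ordered sequences with a last member; theorems are the formulas derivable from $\emptyset$; $T$ is consistent if not every formula is derivable from $T$. **Theorem.** $Ax^{CON}_{PCK^{fo}}$ is strongly complete for $\mathcal M^{MEAS,CON}_{\mathcal A}$: for every theory $T$ that is consistent in $Ax^{CON}_{PCK^{fo}}$ there are a model $M\in\mathcal M^{MEAS,CON}_{\mathcal A}$ and a state $s$ of $M$ such that $(M,s)\models\varphi$ (i.e. $(M,s,v)\models\varphi$ for all valuations $v$) for all $\varphi\in T$. -/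

import Mathlib

namespace PCK

universe u

/-! ## The language -/

/-- The rational unit interval, i.e. the thresholds allowed in the probability operators. -/
abbrev Q01 : Type := Set.Icc (0 : ℚ) 1

/-- `1 - r`. -/
def Q01.compl (r : Q01) : Q01 :=
  ⟨1 - r.1, by have h := r.2.2; linarith, by have h := r.2.1; linarith⟩

/-- First-order terms. The variables are `x_0, x_1, …`, and `func m k` is the `k`-th function symbol
of arity `m`; constants are the function symbols of arity `0`. -/
inductive Term : Type
  | var (x : ℕ) : Term
  | func (m k : ℕ) (ts : Fin m → Term) : Term

/-- Formulas over the set `A` of agents and the set `𝒢` of groups. `rel m k` is the `k`-th relation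
symbol of arity `m`; `know i` is `K_i`, `every G` is `E_G`, `common G` is `C_G`, `prob i r` is
`P_{i,≥ r}`, `everyP G r` is `E_G^r` and `commonP G r` is `C_G^r`. -/
inductive Formula (A : Type u) (𝒢 : Set (Set A)) : Type u
  | rel (m k : ℕ) (ts : Fin m → Term) : Formula A 𝒢
  | neg (φ : Formula A 𝒢) : Formula A 𝒢
  | and (φ ψ : Formula A 𝒢) : Formula A 𝒢
  | all (x : ℕ) (φ : Formula A 𝒢) : Formula A 𝒢
  | know (i : A) (φ : Formula A 𝒢) : Formula A 𝒢
  | every (G : 𝒢) (φ : Formula A 𝒢) : Formula A 𝒢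
  | common (G : 𝒢) (φ : Formula A 𝒢) : Formula A 𝒢
  | prob (i : A) (r : Q01) (φ : Formula A 𝒢) : Formula A 𝒢
  | everyP (G : 𝒢) (r : Q01) (φ : Formula A 𝒢) : Formula A 𝒢
  | commonP (G : 𝒢) (r : Q01) (φ : Formula A 𝒢) : Formula A 𝒢

/-- The variables of a term. -/
def Term.vars : Term → Finset ℕ
  | .var x => {x}
  | .func _ _ ts => Finset.univ.biUnion fun j => (ts j).vars

/-- `Term.subst x t s` replaces every occurrence of the variable `x` in `s` by `t`. -/
def Term.subst (x : ℕ) (t : Term) : Term → Term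
  | .var y => if y = x then t else .var y
  | .func m k ts => .func m k fun j => Term.subst x t (ts j)

namespace Formula

variable {A : Type u} {𝒢 : Set (Set A)}

/-- `φ → ψ`. -/
def imp (φ ψ : Formula A 𝒢) : Formula A 𝒢 := neg (and φ (neg ψ))

/-- `φ ∨ ψ`. -/
def or (φ ψ : Formula A 𝒢) : Formula A 𝒢 := neg (and (neg φ) (neg ψ))

/-- `⊥`. -/
def bot : Formula A 𝒢 := and (rel 0 0 Fin.elim0) (neg (rel 0 0 Fin.elim0))

/-- `⊤`. -/
def top : Formula A 𝒢 := neg bot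

/-- `P_{i,< r} φ`. -/
def probLt (i : A) (r : Q01) (φ : Formula A 𝒢) : Formula A 𝒢 := neg (prob i r φ)

/-- `P_{i,≤ r} φ`. -/
def probLe (i : A) (r : Q01) (φ : Formula A 𝒢) : Formula A 𝒢 := prob i r.compl (neg φ)

/-- `K_i^r φ`, that is `K_i (P_{i,≥ r} φ)`. -/
def knowP (i : A) (r : Q01) (φ : Formula A 𝒢) : Formula A 𝒢 := know i (prob i r φ)

/-- `(E_G)^m φ`. Only the exponents `m ≥ 1` are used below. -/
def everyPow (G : 𝒢) : ℕ → Formula A 𝒢 → Formula A 𝒢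
  | 0, φ => φ
  | m + 1, φ => every G (everyPow G m φ)

/-- `(F_G^r)^m φ`, with `(F_G^r)^0 φ = ⊤` and `(F_G^r)^(m+1) φ = E_G^r (φ ∧ (F_G^r)^m φ)`. -/
def fPow (G : 𝒢) (r : Q01) : ℕ → Formula A 𝒢 → Formula A 𝒢
  | 0, _ => top
  | m + 1, φ => everyP G r (and φ (fPow G r m φ))

/-- The free variables of a formula. -/
def fv : Formula A 𝒢 → Finset ℕ
  | rel _ _ ts => Finset.univ.biUnion fun j => (ts j).vars
  | neg φ => φ.fv
  | and φ ψ => φ.fv ∪ ψ.fv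
  | all x φ => φ.fv.erase x
  | know _ φ => φ.fv
  | every _ φ => φ.fv
  | common _ φ => φ.fv
  | prob _ _ φ => φ.fv
  | everyP _ _ φ => φ.fv
  | commonP _ _ φ => φ.fv

/-- A sentence is a formula without free variables. -/
def IsSentence (φ : Formula A 𝒢) : Prop := φ.fv = ∅

/-- `φ.subst x t` replaces every free occurrence of `x` in `φ` by `t` (with no renaming of bound
variables; it is only used where `t` is free for `x` in `φ`). -/
def subst (x : ℕ) (t : Term) : Formula A 𝒢 → Formula A 𝒢
  | rel m k ts => rel m k fun j => Term.subst x t (ts j)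
  | neg φ => neg (φ.subst x t)
  | and φ ψ => and (φ.subst x t) (ψ.subst x t)
  | all y φ => if y = x then all y φ else all y (φ.subst x t)
  | know i φ => know i (φ.subst x t)
  | every G φ => every G (φ.subst x t)
  | common G φ => common G (φ.subst x t)
  | prob i r φ => prob i r (φ.subst x t)
  | everyP G r φ => everyP G r (φ.subst x t)
  | commonP G r φ => commonP G r (φ.subst x t)

/-- The term `t` is free for `x` in the formula: no free occurrence of `x` is in the scope of a
quantifier that binds a variable of `t`. -/
def FreeFor (x : ℕ) (t : Term) : Formula A 𝒢 → Prop
  | rel _ _ _ => True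
  | neg φ => φ.FreeFor x t
  | and φ ψ => φ.FreeFor x t ∧ ψ.FreeFor x t
  | all y φ => x ∉ (all y φ).fv ∨ (y ∉ t.vars ∧ φ.FreeFor x t)
  | know _ φ => φ.FreeFor x t
  | every _ φ => φ.FreeFor x t
  | common _ φ => φ.FreeFor x t
  | prob _ _ φ => φ.FreeFor x t
  | everyP _ _ φ => φ.FreeFor x t
  | commonP _ _ φ => φ.FreeFor x t

/-- The truth value of a formula as a propositional combination of formulas whose main symbol is
neither `¬` nor `∧`, where `e` assigns a truth value to each of those. -/
def propEval (e : Formula A 𝒢 → Prop) : Formula A 𝒢 → Prop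
  | neg φ => ¬ φ.propEval e
  | and φ ψ => φ.propEval e ∧ ψ.propEval e
  | φ => e φ

/-- The formula is an instance of a tautology of the propositional calculus. -/
def IsTautology (φ : Formula A 𝒢) : Prop := ∀ e : Formula A 𝒢 → Prop, φ.propEval e

end Formula

/-- The operators `K_i` and `P_{i,≥ 1}` that may occur in nested implications. -/
inductive NestOp (A : Type u) : Type u
  | know (i : A) : NestOp A
  | probOne (i : A) : NestOp A

/-- Application of such an operator to a formula. -/
def NestOp.app {A : Type u} {𝒢 : Set (Set A)} : NestOp A → Formula A 𝒢 → Formula A 𝒢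
  | .know i, φ => .know i φ
  | .probOne i, φ => .prob i 1 φ

/-- The `k`-nested implication `Φ_{k,θ,X}(τ)`. Only `θ 0, …, θ k` and `X 1, …, X k` matter. -/
def nested {A : Type u} {𝒢 : Set (Set A)} (θ : ℕ → Formula A 𝒢) (X : ℕ → NestOp A) :
    ℕ → Formula A 𝒢 → Formula A 𝒢
  | 0, τ => (θ 0).imp τ
  | k + 1, τ => (θ (k + 1)).imp ((X (k + 1)).app (nested θ X k τ))

/-! ## The deductive system -/

section Deduction

variable {A : Type u} {𝒢 : Set (Set A)}

open Formula

/-- The instances of the schemata of `Ax_{PCK^fo}`. -/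
inductive BaseSchema : Formula A 𝒢 → Prop
  | taut (φ : Formula A 𝒢) (h : φ.IsTautology) : BaseSchema φ
  | fo1 (x : ℕ) (φ ψ : Formula A 𝒢) (h : x ∉ φ.fv) :
      BaseSchema ((all x (φ.imp ψ)).imp (φ.imp (all x ψ)))
  | fo2 (x : ℕ) (φ : Formula A 𝒢) (t : Term) (h : φ.FreeFor x t) :
      BaseSchema ((all x φ).imp (φ.subst x t))
  | fo3 (x : ℕ) (i : A) (φ : Formula A 𝒢) :
      BaseSchema ((all x (know i φ)).imp (know i (all x φ)))
  | ak (i : A) (φ ψ : Formula A 𝒢) :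
      BaseSchema ((and (know i φ) (know i (φ.imp ψ))).imp (know i ψ))
  | ae (G : 𝒢) (i : A) (hi : i ∈ G.1) (φ : Formula A 𝒢) :
      BaseSchema ((every G φ).imp (know i φ))
  | ac (G : 𝒢) (m : ℕ) (hm : 1 ≤ m) (φ : Formula A 𝒢) :
      BaseSchema ((common G φ).imp (everyPow G m φ))
  | p1 (i : A) (φ : Formula A 𝒢) : BaseSchema (prob i 0 φ)
  | p2 (i : A) (r t : Q01) (h : r < t) (φ : Formula A 𝒢) :
      BaseSchema ((probLe i r φ).imp (probLt i t φ))
  | p3 (i : A) (t : Q01) (φ : Formula A 𝒢) :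
      BaseSchema ((probLt i t φ).imp (probLe i t φ))
  | p4 (i : A) (r t q : Q01) (h : (q : ℚ) = min 1 ((r : ℚ) + (t : ℚ))) (φ ψ : Formula A 𝒢) :
      BaseSchema ((and (and (prob i r φ) (prob i t ψ)) (prob i 1 (neg (and φ ψ)))).imp
        (prob i q (φ.or ψ)))
  | p5 (i : A) (r t q : Q01) (h : (q : ℚ) = (r : ℚ) + (t : ℚ)) (φ ψ : Formula A 𝒢) :
      BaseSchema ((and (probLe i r φ) (probLt i t ψ)).imp (probLt i q (φ.or ψ)))
  | ape (G : 𝒢) (r : Q01) (i : A) (hi : i ∈ G.1) (φ : Formula A 𝒢) :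
      BaseSchema ((everyP G r φ).imp (knowP i r φ))
  | apc (G : 𝒢) (r : Q01) (m : ℕ) (φ : Formula A 𝒢) :
      BaseSchema ((commonP G r φ).imp (fPow G r m φ))

/-- The instances of the schemata of `Ax_{PCK^fo}^{CON}`: those of `Ax_{PCK^fo}` and, in addition,
the consistency schema CON. -/
inductive ConSchema : Formula A 𝒢 → Prop
  | base (φ : Formula A 𝒢) (h : BaseSchema φ) : ConSchema φ
  | con (i : A) (φ : Formula A 𝒢) : ConSchema ((know i φ).imp (prob i 1 φ))

/-- `Derivable T φ` is `T ⊢ φ` in `Ax_{PCK^fo}^{CON}`: the inference rules are those of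
`Ax_{PCK^fo}` without RP, and the premise of RK has to be a theorem, i.e. derivable from `∅`.
Since every rule has at most countably many premises if there are at most countably many agents,
this is the same as the existence of a proof that is an at most countable well-ordered sequence
of formulas with a last member. -/
inductive Derivable : Set (Formula A 𝒢) → Formula A 𝒢 → Prop
  | schema {T : Set (Formula A 𝒢)} (φ : Formula A 𝒢) (h : ConSchema φ) : Derivable T φ
  | hyp {T : Set (Formula A 𝒢)} (φ : Formula A 𝒢) (h : φ ∈ T) : Derivable T φ
  | mp {T : Set (Formula A 𝒢)} (φ ψ : Formula A 𝒢)
      (h₁ : Derivable T φ) (h₂ : Derivable T (φ.imp ψ)) : Derivable T ψ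
  | gen {T : Set (Formula A 𝒢)} (x : ℕ) (φ : Formula A 𝒢)
      (h : Derivable T φ) : Derivable T (all x φ)
  | rk {T : Set (Formula A 𝒢)} (i : A) (φ : Formula A 𝒢)
      (h : Derivable ∅ φ) : Derivable T (know i φ)
  | re {T : Set (Formula A 𝒢)} (k : ℕ) (θ : ℕ → Formula A 𝒢) (X : ℕ → NestOp A)
      (G : 𝒢) (φ : Formula A 𝒢)
      (h : ∀ i ∈ G.1, Derivable T (nested θ X k (know i φ))) :
      Derivable T (nested θ X k (every G φ))
  | rc {T : Set (Formula A 𝒢)} (k : ℕ) (θ : ℕ → Formula A 𝒢) (X : ℕ → NestOp A)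
      (G : 𝒢) (φ : Formula A 𝒢)
      (h : ∀ m : ℕ, 1 ≤ m → Derivable T (nested θ X k (everyPow G m φ))) :
      Derivable T (nested θ X k (common G φ))
  | ra {T : Set (Formula A 𝒢)} (k : ℕ) (θ : ℕ → Formula A 𝒢) (X : ℕ → NestOp A)
      (i : A) (r : Q01) (hr : 0 < r) (φ : Formula A 𝒢)
      (h : ∀ (m : ℕ) (q : Q01), 1 / (r : ℚ) ≤ (m : ℚ) → (q : ℚ) = (r : ℚ) - 1 / (m : ℚ) →
        Derivable T (nested θ X k (prob i q φ))) :
      Derivable T (nested θ X k (prob i r φ))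
  | rpe {T : Set (Formula A 𝒢)} (k : ℕ) (θ : ℕ → Formula A 𝒢) (X : ℕ → NestOp A)
      (G : 𝒢) (r : Q01) (φ : Formula A 𝒢)
      (h : ∀ i ∈ G.1, Derivable T (nested θ X k (knowP i r φ))) :
      Derivable T (nested θ X k (everyP G r φ))
  | rpc {T : Set (Formula A 𝒢)} (k : ℕ) (θ : ℕ → Formula A 𝒢) (X : ℕ → NestOp A)
      (G : 𝒢) (r : Q01) (φ : Formula A 𝒢)
      (h : ∀ m : ℕ, Derivable T (nested θ X k (fPow G r m φ))) :
      Derivable T (nested θ X k (commonP G r φ))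

/-- A set of formulas is inconsistent if every formula is derivable from it, and consistent
otherwise. -/
def Consistent (T : Set (Formula A 𝒢)) : Prop := ¬ ∀ φ : Formula A 𝒢, Derivable T φ

end Deduction

/-! ## Semantics -/

/-- A finitely additive probability space on a nonempty subset of `S`. The function `μ` is only
meaningful on the measurable sets, i.e. the members of the algebra `events`. -/
structure FinAddProbSpace (S : Type u) where
  sample : Set S
  sample_nonempty : sample.Nonempty
  events : Set (Set sample)
  isSetAlgebra : MeasureTheory.IsSetAlgebra events
  μ : Set sample → ℝ
  μ_nonneg : ∀ E ∈ events, 0 ≤ μ E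
  μ_le_one : ∀ E ∈ events, μ E ≤ 1
  μ_univ : μ Set.univ = 1
  μ_union : ∀ E ∈ events, ∀ F ∈ events, E ∩ F = ∅ → μ (E ∪ F) = μ E + μ F

/-- A model `(S, D, I, 𝒦, 𝒫)`. The domain is the same in all states and the function symbols are
rigid, so that their interpretation does not depend on the state. -/
structure Model (A : Type u) where
  S : Type u
  S_nonempty : Nonempty S
  D : Type u
  D_nonempty : Nonempty D
  funI : (m k : ℕ) → (Fin m → D) → D
  relI : S → (m k : ℕ) → Set (Fin m → D)
  K : A → S → Set S
  P : A → S → FinAddProbSpace S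

namespace Model

variable {A : Type u} {𝒢 : Set (Set A)} (M : Model A)

/-- The value of a term under a valuation. -/
def value (v : ℕ → M.D) : Term → M.D
  | .var x => v x
  | .func m k ts => M.funI m k fun j => value v (ts j)

/-- The states where agent `i` knows the event `E`. -/
def knowSet (i : A) (E : Set M.S) : Set M.S := {s | ∀ t ∈ M.K i s, t ∈ E}

/-- The states where everyone in `G` knows the event `E`. -/
def everySet (G : Set A) (E : Set M.S) : Set M.S := {s | ∀ i ∈ G, s ∈ M.knowSet i E}

/-- The states where the probability of the event `E` according to agent `i` is at least `r`. -/
def probSet (i : A) (r : Q01) (E : Set M.S) : Set M.S :=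
  {s | ((r : ℚ) : ℝ) ≤ (M.P i s).μ {t | (t : M.S) ∈ E}}

/-- The states where everyone in `G` knows that the probability of `E` is at least `r`. -/
def everyPSet (G : Set A) (r : Q01) (E : Set M.S) : Set M.S :=
  {s | ∀ i ∈ G, s ∈ M.knowSet i (M.probSet i r E)}

/-- The event that corresponds to `(F_G^r)^m`. -/
def fSet (G : Set A) (r : Q01) (E : Set M.S) : ℕ → Set M.S
  | 0 => Set.univ
  | m + 1 => M.everyPSet G r (E ∩ fSet G r E m)

/-- Satisfaction `(M, s, v) ⊨ φ`. The clauses for `C_G` and `C_G^r` are stated through events,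
which makes the recursion structural; see `sat_common_iff` and `sat_commonP_iff`. -/
def Sat : Formula A 𝒢 → M.S → (ℕ → M.D) → Prop
  | .rel m k ts, s, v => (fun j => M.value v (ts j)) ∈ M.relI s m k
  | .neg φ, s, v => ¬ Sat φ s v
  | .and φ ψ, s, v => Sat φ s v ∧ Sat ψ s v
  | .all x φ, s, v => ∀ d : M.D, Sat φ s (Function.update v x d)
  | .know i φ, s, v => s ∈ M.knowSet i {t | Sat φ t v}
  | .every G φ, s, v => s ∈ M.everySet G.1 {t | Sat φ t v}
  | .common G φ, s, v => ∀ m : ℕ, 1 ≤ m → s ∈ (M.everySet G.1)^[m] {t | Sat φ t v}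
  | .prob i r φ, s, v => s ∈ M.probSet i r {t | Sat φ t v}
  | .everyP G r φ, s, v => s ∈ M.everyPSet G.1 r {t | Sat φ t v}
  | .commonP G r φ, s, v => ∀ m : ℕ, s ∈ M.fSet G.1 r {t | Sat φ t v} m

theorem setOf_sat_everyPow (G : 𝒢) (φ : Formula A 𝒢) (v : ℕ → M.D) (m : ℕ) :
    {t | M.Sat (φ.everyPow G m) t v} = (M.everySet G.1)^[m] {t | M.Sat φ t v} := by
  induction m with
  | zero => rfl
  | succ m ih =>
    rw [Function.iterate_succ_apply', ← ih]
    rfl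

theorem setOf_sat_fPow (G : 𝒢) (r : Q01) (φ : Formula A 𝒢) (v : ℕ → M.D) (m : ℕ) :
    {t | M.Sat (φ.fPow G r m) t v} = M.fSet G.1 r {t | M.Sat φ t v} m := by
  induction m with
  | zero =>
    ext t
    simp [Formula.fPow, Formula.top, Formula.bot, Sat, fSet]
  | succ m ih =>
    rw [fSet, ← ih]
    rfl

/-- `(M, s, v) ⊨ C_G φ` iff `(M, s, v) ⊨ (E_G)^m φ` for every `m ≥ 1`. -/
theorem sat_common_iff (G : 𝒢) (φ : Formula A 𝒢) (s : M.S) (v : ℕ → M.D) :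
    M.Sat (.common G φ) s v ↔ ∀ m : ℕ, 1 ≤ m → M.Sat (φ.everyPow G m) s v := by
  refine forall_congr' fun m => forall_congr' fun _ => ?_
  rw [← setOf_sat_everyPow]
  rfl

/-- `(M, s, v) ⊨ C_G^r φ` iff `(M, s, v) ⊨ (F_G^r)^m φ` for every `m`. -/
theorem sat_commonP_iff (G : 𝒢) (r : Q01) (φ : Formula A 𝒢) (s : M.S) (v : ℕ → M.D) :
    M.Sat (.commonP G r φ) s v ↔ ∀ m : ℕ, M.Sat (φ.fPow G r m) s v := by
  refine forall_congr' fun m => ?_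
  rw [← setOf_sat_fPow]
  rfl

/-- The measurable models: every set `{t ∈ S_{i,s} | (M, t, v) ⊨ φ}` is measurable. -/
def IsMeasurable (𝒢 : Set (Set A)) (M : Model A) : Prop :=
  ∀ (φ : Formula A 𝒢) (v : ℕ → M.D) (s : M.S) (i : A),
    {t : (M.P i s).sample | M.Sat φ t.1 v} ∈ (M.P i s).events

/-- The consistency condition `S_{i,s} ⊆ 𝒦_i(s)`. -/
def SatisfiesCon : Prop := ∀ (i : A) (s : M.S), (M.P i s).sample ⊆ M.K i s

/-- `(M, s) ⊨ φ`: satisfaction under every valuation. -/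
def SatAt (s : M.S) (φ : Formula A 𝒢) : Prop := ∀ v : ℕ → M.D, M.Sat φ s v

end Model

end PCK

/-! The proof is a Henkin construction for an infinitary calculus. States are complete sets of
sentences closed under the infinitary rules and under the ω-rule that infers `∀ x φ` from its closed
instances; the domain consists of the closed terms. The states accessible from `s` for agent `i` are
those containing everything that `i` knows in `s`, and they also serve as the sample space, so the
inclusion of sample spaces in accessibility is immediate. The event of `φ` has as measure the
supremum of the `r` with `P_{i,≥ r} φ ∈ s`.

The axiom `K_i φ → P_{i,≥ 1} φ` replaces necessitation for `P_{i,≥ 1}`. It makes the sample space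
nonempty (`acc_nonempty`) and the measure well defined: sentences that agree on all accessible
states are known to be equivalent, hence satisfy the same bounds (`know_imp_prob`,
`prob_mem_of_event_subset`). The Archimedean rule makes membership of `P_{i,≥ r} φ` equivalent to
the measure being at least `r` (`le_measure_iff`), and the two axioms on disjunctions give
additivity (`measure_or`).

An increasing union of consistent sets need not respect infinitary rules. The Lindenbaum lemma
therefore works over a fixed theory `F` closed under these rules (`IsTheory`): a single sentence,
never refuted by `F`, is strengthened to meet countably many requirements (`exists_chain`). Nested
implications are made for this. Their outermost antecedent can absorb the current sentence
(`imp_infer`), and the prefix `⊤ → K_i` shows that the sentences known in a state again form a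
theory (`IsTheory.known`). The same lemma thus yields the initial state and a witness for each
sentence that is not known.

It remains to extend `T` to a theory closed under the ω-rule. `T` may mention every constant, and an
infinite derivation may use every variable, so nothing need be fresh. Doubling the indices of the
constants frees the odd ones, and bound variables are made even. A constant is then generalized by
renaming a whole derivation, with odd variables shifted to make room for a new one
(`Derivable.all_of_closed`). The canonical model is finally read through the doubling
(`Model.halveConst`). -/

namespace PCK

universe u

open Function

/-! ## Syntax -/

namespace Term

/-- Simultaneous substitution of `σ x` for every variable `x`. -/
def msubst (σ : ℕ → Term) : Term → Term
  | .var x => σ x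
  | .func m k ts => .func m k fun j => (ts j).msubst σ

/-- Rename every variable `x` to `ρ x` and replace the `k`-th constant by `g k`. -/
def cmap (ρ : ℕ → ℕ) (g : ℕ → Term) : Term → Term
  | .var x => .var (ρ x)
  | .func m k ts => if m = 0 then g k else .func m k fun j => (ts j).cmap ρ g

theorem mem_vars_func {m k : ℕ} {ts : Fin m → Term} {z : ℕ} :
    z ∈ (func m k ts).vars ↔ ∃ j, z ∈ (ts j).vars := by
  simp [vars]

theorem subst_of_notMem {x : ℕ} {t s : Term} (h : x ∉ s.vars) : subst x t s = s := by
  induction s with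
  | var y =>
    have : y ≠ x := fun e => h (by simp [vars, e])
    simp [subst, this]
  | func m k ts ih =>
    simp only [mem_vars_func, not_exists] at h
    simp only [subst, func.injEq, heq_eq_eq, true_and]
    exact funext fun j => ih j (h j)

theorem subst_self (x : ℕ) (s : Term) : subst x (var x) s = s := by
  induction s with
  | var y => by_cases h : y = x <;> simp [subst, h]
  | func m k ts ih => simp [subst, ih]

theorem vars_subst {x z : ℕ} {t s : Term} (h : z ∈ (subst x t s).vars) :
    (z ∈ s.vars ∧ z ≠ x) ∨ z ∈ t.vars := by
  induction s with
  | var y =>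
    by_cases e : y = x
    · simp only [subst, e, if_true] at h
      exact .inr h
    · simp only [subst, e, if_false, vars, Finset.mem_singleton] at h ⊢
      exact .inl ⟨h, h ▸ e⟩
  | func m k ts ih =>
    simp only [subst, mem_vars_func] at h ⊢
    obtain ⟨j, hj⟩ := h
    rcases ih j hj with ⟨h1, h2⟩ | h1
    · exact .inl ⟨⟨j, h1⟩, h2⟩
    · exact .inr h1

theorem subst_subst_of_notMem {x y : ℕ} {t s : Term} (h : y ∉ s.vars) :
    subst y t (subst x (var y) s) = subst x t s := by
  induction s with
  | var z =>
    have : z ≠ y := fun e => h (by simp [vars, e])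
    by_cases e : z = x <;> simp [subst, e, this]
  | func m k ts ih =>
    simp only [mem_vars_func, not_exists] at h
    simp only [subst, func.injEq, heq_eq_eq, true_and]
    exact funext fun j => ih j (h j)

theorem vars_cmap {ρ : ℕ → ℕ} {g : ℕ → Term} {s : Term} {z : ℕ} (h : z ∈ (s.cmap ρ g).vars) :
    (∃ x ∈ s.vars, ρ x = z) ∨ ∃ k, z ∈ (g k).vars := by
  induction s with
  | var y =>
    simp only [cmap, vars, Finset.mem_singleton] at h
    exact .inl ⟨y, by simp [vars], h.symm⟩
  | func m k ts ih =>
    unfold cmap at h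
    split_ifs at h
    · exact .inr ⟨k, h⟩
    · rw [mem_vars_func] at h
      obtain ⟨j, hj⟩ := h
      rcases ih j hj with ⟨x, h1, h2⟩ | h1
      · exact .inl ⟨x, mem_vars_func.2 ⟨j, h1⟩, h2⟩
      · exact .inr h1

/-- `hg` keeps the variables brought in by `g` outside the range of `ρ`, so the substitution for `ρ
x` cannot touch them. -/
theorem cmap_subst {ρ : ℕ → ℕ} {g : ℕ → Term} (hρ : Injective ρ)
    (hg : ∀ k x, ρ x ∉ (g k).vars) (x : ℕ) (t s : Term) :
    (subst x t s).cmap ρ g = subst (ρ x) (t.cmap ρ g) (s.cmap ρ g) := by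
  induction s with
  | var y =>
    by_cases e : y = x
    · simp [subst, cmap, e]
    · simp [subst, cmap, e, hρ.eq_iff]
  | func m k ts ih =>
    simp only [subst, cmap]
    split_ifs with h
    · rw [subst_of_notMem (hg k x)]
    · simp only [subst, func.injEq, heq_eq_eq, true_and]
      exact funext ih

theorem cmap_cmap_eq_cmap {ρ ρ' : ℕ → ℕ} {g h g' : ℕ → Term} {s : Term}
    (hv : ∀ x ∈ s.vars, ρ x = ρ' x) (hg : ∀ k, (h k).cmap ρ g = g' k) :
    (s.cmap id h).cmap ρ g = s.cmap ρ' g' := by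
  induction s with
  | var y => simp [cmap, hv y (by simp [vars])]
  | func m k ts ih =>
    by_cases e : m = 0
    · simp [cmap, e, hg]
    · simp only [cmap, e, if_false, func.injEq, heq_eq_eq, true_and]
      exact funext fun j => ih j fun x hx => hv x (mem_vars_func.2 ⟨j, hx⟩)

theorem cmap_id (s : Term) : s.cmap id (fun k => func 0 k Fin.elim0) = s := by
  induction s with
  | var y => rfl
  | func m k ts ih =>
    by_cases e : m = 0
    · subst e
      simp only [cmap, if_true, func.injEq, heq_eq_eq, true_and]
      exact funext fun j => j.elim0
    · simp only [cmap, e, if_false, func.injEq, heq_eq_eq, true_and]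
      exact funext ih

/-- A substitution that replaces each variable by itself or by a closed term. -/
def GroundOrFix (σ : ℕ → Term) : Prop := ∀ x, (σ x).vars = ∅ ∨ σ x = var x

theorem GroundOrFix.update {σ : ℕ → Term} (hσ : GroundOrFix σ) (x : ℕ) :
    GroundOrFix (update σ x (var x)) := by
  intro y
  by_cases h : y = x
  · subst h; simp
  · simpa [h] using hσ y

theorem vars_msubst {σ : ℕ → Term} (hσ : GroundOrFix σ) {s : Term} {z : ℕ}
    (h : z ∈ (s.msubst σ).vars) : z ∈ s.vars ∧ σ z = var z := by
  induction s with
  | var y =>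
    rcases hσ y with e | e
    · simp [msubst, e] at h
    · simp only [msubst, e, vars, Finset.mem_singleton] at h ⊢
      subst h
      exact ⟨rfl, e⟩
  | func m k ts ih =>
    simp only [msubst, mem_vars_func] at h ⊢
    obtain ⟨j, hj⟩ := h
    exact ⟨⟨j, (ih j hj).1⟩, (ih j hj).2⟩

theorem subst_msubst {σ : ℕ → Term} (hσ : GroundOrFix σ) {x : ℕ} (hx : σ x = var x) (t s : Term) :
    subst x t (s.msubst σ) = s.msubst (Function.update σ x t) := by
  induction s with
  | var y =>
    by_cases e : y = x
    · subst e; simp [msubst, hx, subst]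
    · simp only [msubst, Function.update_of_ne e]
      refine subst_of_notMem fun h => ?_
      rcases hσ y with e' | e'
      · simp [e'] at h
      · simp only [e', vars, Finset.mem_singleton] at h
        exact e h.symm
  | func m k ts ih => simp [msubst, subst, ih]

theorem msubst_eq_self {σ : ℕ → Term} {s : Term} (h : ∀ x ∈ s.vars, σ x = var x) :
    s.msubst σ = s := by
  induction s with
  | var y => exact h y (by simp [vars])
  | func m k ts ih =>
    simp only [msubst, func.injEq, heq_eq_eq, true_and]
    exact funext fun j => ih j fun x hx => h x (mem_vars_func.2 ⟨j, hx⟩)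

/-- The `k`-th constant. -/
abbrev const (k : ℕ) : Term := func 0 k Fin.elim0

theorem vars_const (k : ℕ) : (const k).vars = ∅ := by
  simp [vars]

end Term

namespace Formula

variable {A : Type u} {𝒢 : Set (Set A)}

/-- Simultaneous substitution of `σ x` for every free variable `x` (without renaming of bound
variables). -/
def msubst (σ : ℕ → Term) : Formula A 𝒢 → Formula A 𝒢
  | rel m k ts => rel m k fun j => (ts j).msubst σ
  | neg φ => neg (φ.msubst σ)
  | and φ ψ => and (φ.msubst σ) (ψ.msubst σ)
  | all x φ => all x (φ.msubst (update σ x (.var x)))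
  | know i φ => know i (φ.msubst σ)
  | every G φ => every G (φ.msubst σ)
  | common G φ => common G (φ.msubst σ)
  | prob i r φ => prob i r (φ.msubst σ)
  | everyP G r φ => everyP G r (φ.msubst σ)
  | commonP G r φ => commonP G r (φ.msubst σ)
termination_by structural φ => φ

/-- Rename every free or bound variable `x` to `ρ x` and replace the `k`-th constant by `g k`. -/
def cmap (ρ : ℕ → ℕ) (g : ℕ → Term) : Formula A 𝒢 → Formula A 𝒢
  | rel m k ts => rel m k fun j => (ts j).cmap ρ g
  | neg φ => neg (φ.cmap ρ g)
  | and φ ψ => and (φ.cmap ρ g) (ψ.cmap ρ g)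
  | all x φ => all (ρ x) (φ.cmap ρ g)
  | know i φ => know i (φ.cmap ρ g)
  | every G φ => every G (φ.cmap ρ g)
  | common G φ => common G (φ.cmap ρ g)
  | prob i r φ => prob i r (φ.cmap ρ g)
  | everyP G r φ => everyP G r (φ.cmap ρ g)
  | commonP G r φ => commonP G r (φ.cmap ρ g)

/-- The variables that are bound by some quantifier of the formula. -/
def bv : Formula A 𝒢 → Finset ℕ
  | rel _ _ _ => ∅
  | neg φ => φ.bv
  | and φ ψ => φ.bv ∪ ψ.bv
  | all x φ => insert x φ.bv
  | know _ φ => φ.bv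
  | every _ φ => φ.bv
  | common _ φ => φ.bv
  | prob _ _ φ => φ.bv
  | everyP _ _ φ => φ.bv
  | commonP _ _ φ => φ.bv

theorem mem_fv_rel {m k : ℕ} {ts : Fin m → Term} {z : ℕ} :
    z ∈ (rel m k ts : Formula A 𝒢).fv ↔ ∃ j, z ∈ (ts j).vars := by
  simp [fv]

@[simp] theorem isSentence_neg {φ : Formula A 𝒢} : (neg φ).IsSentence ↔ φ.IsSentence := Iff.rfl
@[simp] theorem isSentence_know {i : A} {φ : Formula A 𝒢} :
    (know i φ).IsSentence ↔ φ.IsSentence := Iff.rfl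
@[simp] theorem isSentence_every {G : 𝒢} {φ : Formula A 𝒢} :
    (every G φ).IsSentence ↔ φ.IsSentence := Iff.rfl
@[simp] theorem isSentence_common {G : 𝒢} {φ : Formula A 𝒢} :
    (common G φ).IsSentence ↔ φ.IsSentence := Iff.rfl
@[simp] theorem isSentence_prob {i : A} {r : Q01} {φ : Formula A 𝒢} :
    (prob i r φ).IsSentence ↔ φ.IsSentence := Iff.rfl
@[simp] theorem isSentence_everyP {G : 𝒢} {r : Q01} {φ : Formula A 𝒢} :
    (everyP G r φ).IsSentence ↔ φ.IsSentence := Iff.rfl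
@[simp] theorem isSentence_commonP {G : 𝒢} {r : Q01} {φ : Formula A 𝒢} :
    (commonP G r φ).IsSentence ↔ φ.IsSentence := Iff.rfl
@[simp] theorem isSentence_and {φ ψ : Formula A 𝒢} :
    (and φ ψ).IsSentence ↔ φ.IsSentence ∧ ψ.IsSentence := Finset.union_eq_empty
@[simp] theorem isSentence_imp {φ ψ : Formula A 𝒢} :
    (imp φ ψ).IsSentence ↔ φ.IsSentence ∧ ψ.IsSentence := by simp [imp]
@[simp] theorem isSentence_or {φ ψ : Formula A 𝒢} :
    (or φ ψ).IsSentence ↔ φ.IsSentence ∧ ψ.IsSentence := by simp [or]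
@[simp] theorem isSentence_bot : (bot : Formula A 𝒢).IsSentence := by
  simp [bot, IsSentence, fv]
@[simp] theorem isSentence_top : (top : Formula A 𝒢).IsSentence := by simp [top]

theorem isSentence_all {x : ℕ} {φ : Formula A 𝒢} :
    (all x φ).IsSentence ↔ ∀ z ∈ φ.fv, z = x := by
  simp only [IsSentence, fv, Finset.eq_empty_iff_forall_notMem, Finset.mem_erase, not_and]
  exact forall_congr' fun z => by tauto

@[simp] theorem isSentence_everyPow {G : 𝒢} {m : ℕ} {φ : Formula A 𝒢} :
    (everyPow G m φ).IsSentence ↔ φ.IsSentence := by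
  induction m with
  | zero => rfl
  | succ m ih => simpa [everyPow] using ih

theorem isSentence_fPow {G : 𝒢} {r : Q01} {φ : Formula A 𝒢} (h : φ.IsSentence) (m : ℕ) :
    (fPow G r m φ).IsSentence := by
  induction m with
  | zero => simp [fPow]
  | succ m ih => simp [fPow, h, ih]

@[simp] theorem isSentence_app {X : NestOp A} {φ : Formula A 𝒢} :
    (X.app φ).IsSentence ↔ φ.IsSentence := by
  cases X <;> simp [NestOp.app]

/-! ### Substitution -/

theorem subst_of_notMem {x : ℕ} {t : Term} {φ : Formula A 𝒢} (h : x ∉ φ.fv) :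
    φ.subst x t = φ := by
  induction φ with
  | rel m k ts =>
    simp only [mem_fv_rel, not_exists] at h
    simp only [subst, rel.injEq, heq_eq_eq, true_and]
    exact funext fun j => Term.subst_of_notMem (h j)
  | all y φ ih =>
    by_cases e : y = x
    · simp [subst, e]
    · simp only [fv, Finset.mem_erase, not_and] at h
      simp [subst, e, ih (h (Ne.symm e))]
  | and φ ψ ih₁ ih₂ =>
    simp only [fv, Finset.mem_union, not_or] at h
    simp [subst, ih₁ h.1, ih₂ h.2]
  | _ => simp_all [subst, fv]

theorem subst_self (x : ℕ) (φ : Formula A 𝒢) : φ.subst x (.var x) = φ := by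
  induction φ <;> simp_all [subst, Term.subst_self]

theorem freeFor_self (x : ℕ) (φ : Formula A 𝒢) : φ.FreeFor x (.var x) := by
  induction φ with
  | all y φ ih =>
    by_cases e : y = x
    · exact .inl (by simp [fv, e])
    · exact .inr ⟨by simpa [Term.vars] using e, ih⟩
  | _ => simp_all [FreeFor]

theorem freeFor_of_closed {t : Term} (ht : t.vars = ∅) (x : ℕ) (φ : Formula A 𝒢) :
    φ.FreeFor x t := by
  induction φ with
  | all y φ ih => exact .inr ⟨by simp [ht], ih⟩
  | _ => simp_all [FreeFor]

theorem freeFor_var_of_notMem {x y : ℕ} {φ : Formula A 𝒢} (h : y ∉ φ.bv) :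
    φ.FreeFor x (.var y) := by
  induction φ with
  | all z φ ih =>
    simp only [bv, Finset.mem_insert, not_or] at h
    exact .inr ⟨by simpa [Term.vars] using Ne.symm h.1, ih h.2⟩
  | and φ ψ ih₁ ih₂ =>
    simp only [bv, Finset.mem_union, not_or] at h
    exact ⟨ih₁ h.1, ih₂ h.2⟩
  | _ => simp_all [FreeFor, bv]

/-- Since `y` is new, its only occurrences after the first substitution are those that replaced `x`.
This makes renaming of bound variables reversible. -/
theorem subst_subst_of_notMem {x y : ℕ} {φ : Formula A 𝒢} (hf : y ∉ φ.fv) (hb : y ∉ φ.bv) :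
    (φ.subst x (.var y)).subst y (.var x) = φ := by
  induction φ with
  | rel m k ts =>
    simp only [mem_fv_rel, not_exists] at hf
    simp only [subst, rel.injEq, heq_eq_eq, true_and]
    exact funext fun j => by rw [Term.subst_subst_of_notMem (hf j), Term.subst_self]
  | all z φ ih =>
    simp only [bv, Finset.mem_insert, not_or] at hb
    simp only [fv, Finset.mem_erase, not_and] at hf
    have hf := hf hb.1
    by_cases e : z = x
    · simp [subst, e, subst_of_notMem hf]
    · simp [subst, e, Ne.symm hb.1, ih hf hb.2]
  | and φ ψ ih₁ ih₂ =>
    simp only [bv, fv, Finset.mem_union, not_or] at hb hf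
    simp [subst, ih₁ hf.1 hb.1, ih₂ hf.2 hb.2]
  | _ => simp_all [subst, fv, bv]

theorem freeFor_subst_var {x y : ℕ} {φ : Formula A 𝒢} (hf : y ∉ φ.fv) (hb : y ∉ φ.bv) :
    (φ.subst x (.var y)).FreeFor y (.var x) := by
  induction φ with
  | all z φ ih =>
    by_cases e : z = x
    · simp only [subst, e, if_true]
      exact .inl (by simpa only [e] using hf)
    · simp only [bv, Finset.mem_insert, not_or] at hb
      simp only [fv, Finset.mem_erase, not_and] at hf
      simp only [subst, e, if_false]
      exact .inr ⟨by simpa [Term.vars] using e, ih (hf hb.1) hb.2⟩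
  | and φ ψ ih₁ ih₂ =>
    simp only [bv, fv, Finset.mem_union, not_or] at hb hf
    exact ⟨ih₁ hf.1 hb.1, ih₂ hf.2 hb.2⟩
  | _ => simp_all [subst, fv, bv, FreeFor]

theorem fv_subst {x z : ℕ} {t : Term} {φ : Formula A 𝒢} (h : z ∈ (φ.subst x t).fv) :
    (z ∈ φ.fv ∧ z ≠ x) ∨ z ∈ t.vars := by
  induction φ with
  | rel m k ts =>
    simp only [subst, mem_fv_rel] at h ⊢
    obtain ⟨j, hj⟩ := h
    rcases Term.vars_subst hj with h | h
    · exact .inl ⟨⟨j, h.1⟩, h.2⟩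
    · exact .inr h
  | all y φ ih =>
    by_cases e : y = x
    · simp only [subst, e, if_true, fv, Finset.mem_erase] at h ⊢
      exact .inl ⟨h, h.1⟩
    · simp only [subst, e, if_false, fv, Finset.mem_erase] at h ⊢
      rcases ih h.2 with h' | h'
      · exact .inl ⟨⟨h.1, h'.1⟩, h'.2⟩
      · exact .inr h'
  | and φ ψ ih₁ ih₂ =>
    simp only [subst, fv, Finset.mem_union] at h ⊢
    rcases h with h | h
    · have := ih₁ h; tauto
    · have := ih₂ h; tauto
  | _ => simp_all [subst, fv]

theorem bv_subst (x : ℕ) (t : Term) (φ : Formula A 𝒢) : (φ.subst x t).bv = φ.bv := by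
  induction φ with
  | all y φ ih => by_cases e : y = x <;> simp [subst, e, bv, ih]
  | _ => simp_all [subst, bv]

theorem isSentence_subst {x : ℕ} {t : Term} {φ : Formula A 𝒢} (hφ : (all x φ).IsSentence)
    (ht : t.vars = ∅) : (φ.subst x t).IsSentence := by
  refine Finset.eq_empty_iff_forall_notMem.2 fun z hz => ?_
  rcases fv_subst hz with h | h
  · exact h.2 (isSentence_all.1 hφ z h.1)
  · simp [ht] at h

/-! ### Simultaneous substitution -/

theorem fv_msubst {σ : ℕ → Term} (hσ : Term.GroundOrFix σ) {φ : Formula A 𝒢} {z : ℕ}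
    (h : z ∈ (φ.msubst σ).fv) : z ∈ φ.fv ∧ σ z = .var z := by
  induction φ generalizing σ with
  | rel m k ts =>
    simp only [msubst, mem_fv_rel] at h ⊢
    obtain ⟨j, hj⟩ := h
    exact ⟨⟨j, (Term.vars_msubst hσ hj).1⟩, (Term.vars_msubst hσ hj).2⟩
  | all y φ ih =>
    simp only [msubst, fv, Finset.mem_erase] at h ⊢
    have := ih (hσ.update y) h.2
    rw [update_of_ne h.1] at this
    exact ⟨⟨h.1, this.1⟩, this.2⟩
  | and φ ψ ih₁ ih₂ =>
    simp only [msubst, fv, Finset.mem_union] at h ⊢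
    rcases h with h | h
    · have := ih₁ hσ h; tauto
    · have := ih₂ hσ h; tauto
  | neg φ ih => exact ih hσ h
  | know i φ ih => exact ih hσ h
  | every i φ ih => exact ih hσ h
  | common i φ ih => exact ih hσ h
  | prob i r φ ih => exact ih hσ h
  | everyP i r φ ih => exact ih hσ h
  | commonP i r φ ih => exact ih hσ h

theorem isSentence_msubst {σ : ℕ → Term} (hσ : ∀ x, (σ x).vars = ∅) (φ : Formula A 𝒢) :
    (φ.msubst σ).IsSentence := by
  refine Finset.eq_empty_iff_forall_notMem.2 fun z hz => ?_
  have h := (fv_msubst (fun x => .inl (hσ x)) hz).2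
  simpa [h, Term.vars] using hσ z

theorem subst_msubst {σ : ℕ → Term} (hσ : Term.GroundOrFix σ) {x : ℕ} (hx : σ x = .var x)
    (t : Term) (φ : Formula A 𝒢) :
    (φ.msubst σ).subst x t = φ.msubst (update σ x t) := by
  induction φ generalizing σ with
  | rel m k ts => simp [msubst, subst, Term.subst_msubst hσ hx]
  | all y φ ih =>
    by_cases e : y = x
    · subst e
      simp [msubst, subst]
    · simp only [msubst, subst, e, if_false]
      rw [ih (hσ.update y) (by rw [update_of_ne (Ne.symm e), hx]), update_comm e]
  | _ => simp_all [msubst, subst]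

theorem msubst_eq_self {σ : ℕ → Term} {φ : Formula A 𝒢} (h : ∀ x ∈ φ.fv, σ x = .var x) :
    φ.msubst σ = φ := by
  induction φ generalizing σ with
  | rel m k ts =>
    simp only [msubst, rel.injEq, heq_eq_eq, true_and]
    exact funext fun j => Term.msubst_eq_self fun x hx => h x (mem_fv_rel.2 ⟨j, hx⟩)
  | all y φ ih =>
    simp only [msubst, all.injEq, true_and]
    refine ih fun x hx => ?_
    by_cases e : x = y
    · subst e; simp
    · rw [update_of_ne e]
      exact h x (by simp [fv, e, hx])
  | and φ ψ ih₁ ih₂ =>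
    simp only [fv, Finset.mem_union] at h
    simp only [msubst]
    rw [ih₁ fun x hx => h x (.inl hx), ih₂ fun x hx => h x (.inr hx)]
  | neg φ ih => exact congrArg _ (ih h)
  | know i φ ih => exact congrArg _ (ih h)
  | every i φ ih => exact congrArg _ (ih h)
  | common i φ ih => exact congrArg _ (ih h)
  | prob i r φ ih => exact congrArg _ (ih h)
  | everyP i r φ ih => exact congrArg _ (ih h)
  | commonP i r φ ih => exact congrArg _ (ih h)

theorem msubst_everyPow (σ : ℕ → Term) (G : 𝒢) (m : ℕ) (φ : Formula A 𝒢) :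
    (everyPow G m φ).msubst σ = everyPow G m (φ.msubst σ) := by
  induction m with
  | zero => rfl
  | succ m ih => simp [everyPow, msubst, ih]

theorem msubst_fPow (σ : ℕ → Term) (G : 𝒢) (r : Q01) (m : ℕ) (φ : Formula A 𝒢) :
    (fPow G r m φ).msubst σ = fPow G r m (φ.msubst σ) := by
  induction m with
  | zero =>
    have h : (top : Formula A 𝒢).fv = ∅ := isSentence_top
    exact msubst_eq_self fun x hx => by simp [fPow, h] at hx
  | succ m ih => simp [fPow, msubst, ih]

/-! ### Renaming of variables and constants -/

theorem fv_cmap {ρ : ℕ → ℕ} {g : ℕ → Term} {φ : Formula A 𝒢} {z : ℕ}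
    (h : z ∈ (φ.cmap ρ g).fv) : (∃ x ∈ φ.fv, ρ x = z) ∨ ∃ k, z ∈ (g k).vars := by
  induction φ with
  | rel m k ts =>
    simp only [cmap, mem_fv_rel] at h ⊢
    obtain ⟨j, hj⟩ := h
    rcases Term.vars_cmap hj with ⟨x, h1, h2⟩ | h1
    · exact .inl ⟨x, ⟨j, h1⟩, h2⟩
    · exact .inr h1
  | all y φ ih =>
    simp only [cmap, fv, Finset.mem_erase] at h ⊢
    rcases ih h.2 with ⟨x, h1, h2⟩ | h1
    · exact .inl ⟨x, ⟨fun e => h.1 (by rw [← h2, e]), h1⟩, h2⟩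
    · exact .inr h1
  | and φ ψ ih₁ ih₂ =>
    simp only [cmap, fv, Finset.mem_union] at h ⊢
    rcases h with h | h
    · rcases ih₁ h with ⟨x, h1, h2⟩ | h1
      · exact .inl ⟨x, .inl h1, h2⟩
      · exact .inr h1
    · rcases ih₂ h with ⟨x, h1, h2⟩ | h1
      · exact .inl ⟨x, .inr h1, h2⟩
      · exact .inr h1
  | _ => simp_all [cmap, fv]

theorem notMem_fv_cmap {ρ : ℕ → ℕ} {g : ℕ → Term} (hρ : Injective ρ)
    (hg : ∀ k x, ρ x ∉ (g k).vars) {φ : Formula A 𝒢} {x : ℕ} (h : x ∉ φ.fv) :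
    ρ x ∉ (φ.cmap ρ g).fv := fun h' => by
  rcases fv_cmap h' with ⟨y, h1, h2⟩ | ⟨k, hk⟩
  · exact h (hρ h2 ▸ h1)
  · exact hg k x hk

theorem cmap_subst {ρ : ℕ → ℕ} {g : ℕ → Term} (hρ : Injective ρ)
    (hg : ∀ k x, ρ x ∉ (g k).vars) (x : ℕ) (t : Term) (φ : Formula A 𝒢) :
    (φ.subst x t).cmap ρ g = (φ.cmap ρ g).subst (ρ x) (t.cmap ρ g) := by
  induction φ with
  | rel m k ts => simp [cmap, subst, Term.cmap_subst hρ hg]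
  | all y φ ih => by_cases e : y = x <;> simp [cmap, subst, e, hρ.eq_iff, ih]
  | _ => simp_all [cmap, subst]

/-- Quantified variables of the renamed formula lie in the range of `ρ`, so they cannot capture a
variable introduced by `g`. -/
theorem freeFor_cmap {ρ : ℕ → ℕ} {g : ℕ → Term} (hρ : Injective ρ)
    (hg : ∀ k x, ρ x ∉ (g k).vars) {x : ℕ} {t : Term} {φ : Formula A 𝒢} (h : φ.FreeFor x t) :
    (φ.cmap ρ g).FreeFor (ρ x) (t.cmap ρ g) := by
  induction φ with
  | all y φ ih =>
    rcases h with h | h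
    · exact .inl (notMem_fv_cmap (φ := all y φ) hρ hg h)
    · refine .inr ⟨fun h' => ?_, ih h.2⟩
      rcases Term.vars_cmap h' with ⟨z, h1, h2⟩ | ⟨k, hk⟩
      · exact h.1 (hρ h2 ▸ h1)
      · exact hg k y hk
  | _ => simp_all [cmap, FreeFor]

/-- Renaming preserves main symbols, hence the propositional skeleton; so tautologies stay
tautologies. -/
theorem propEval_cmap (ρ : ℕ → ℕ) (g : ℕ → Term) (e : Formula A 𝒢 → Prop) (φ : Formula A 𝒢) :
    (φ.cmap ρ g).propEval e ↔ φ.propEval fun ψ => e (ψ.cmap ρ g) := by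
  induction φ with
  | neg φ ih => exact not_congr ih
  | and φ ψ ih₁ ih₂ => exact and_congr ih₁ ih₂
  | _ => exact Iff.rfl

@[simp] theorem cmap_imp (ρ : ℕ → ℕ) (g : ℕ → Term) (φ ψ : Formula A 𝒢) :
    (φ.imp ψ).cmap ρ g = (φ.cmap ρ g).imp (ψ.cmap ρ g) := rfl

theorem cmap_top (ρ : ℕ → ℕ) (g : ℕ → Term) : (top : Formula A 𝒢).cmap ρ g = top := by
  simp only [top, bot, cmap, neg.injEq, and.injEq, rel.injEq, heq_eq_eq, true_and, and_self]
  exact funext fun j => j.elim0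

theorem cmap_everyPow (ρ : ℕ → ℕ) (g : ℕ → Term) (G : 𝒢) (m : ℕ) (φ : Formula A 𝒢) :
    (everyPow G m φ).cmap ρ g = everyPow G m (φ.cmap ρ g) := by
  induction m with
  | zero => rfl
  | succ m ih => simp [everyPow, cmap, ih]

theorem cmap_fPow (ρ : ℕ → ℕ) (g : ℕ → Term) (G : 𝒢) (r : Q01) (m : ℕ) (φ : Formula A 𝒢) :
    (fPow G r m φ).cmap ρ g = fPow G r m (φ.cmap ρ g) := by
  induction m with
  | zero => exact cmap_top ρ g
  | succ m ih => simp [fPow, cmap, ih]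

theorem cmap_nested (ρ : ℕ → ℕ) (g : ℕ → Term) (θ : ℕ → Formula A 𝒢) (X : ℕ → NestOp A) (k : ℕ)
    (τ : Formula A 𝒢) :
    (nested θ X k τ).cmap ρ g = nested (fun j => (θ j).cmap ρ g) X k (τ.cmap ρ g) := by
  induction k with
  | zero => rfl
  | succ k ih =>
    simp only [nested, cmap_imp, ← ih]
    cases X (k + 1) <;> rfl

theorem cmap_cmap_eq_cmap {ρ ρ' : ℕ → ℕ} {g h g' : ℕ → Term} {φ : Formula A 𝒢}
    (hf : ∀ x ∈ φ.fv, ρ x = ρ' x) (hb : ∀ x ∈ φ.bv, ρ x = ρ' x)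
    (hg : ∀ k, (h k).cmap ρ g = g' k) :
    (φ.cmap id h).cmap ρ g = φ.cmap ρ' g' := by
  induction φ with
  | rel m k ts =>
    simp only [cmap, rel.injEq, heq_eq_eq, true_and]
    exact funext fun j =>
      Term.cmap_cmap_eq_cmap (fun x hx => hf x (mem_fv_rel.2 ⟨j, hx⟩)) hg
  | all y φ ih =>
    simp only [bv, Finset.mem_insert, forall_eq_or_imp, fv, Finset.mem_erase] at hb hf
    simp only [cmap, id, hb.1, all.injEq, true_and]
    refine ih (fun x hx => ?_) hb.2
    by_cases e : x = y
    · rw [e, hb.1]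
    · exact hf x ⟨e, hx⟩
  | and φ ψ ih₁ ih₂ =>
    simp only [bv, fv, Finset.mem_union] at hb hf
    simp only [cmap]
    rw [ih₁ (fun x hx => hf x (.inl hx)) fun x hx => hb x (.inl hx),
      ih₂ (fun x hx => hf x (.inr hx)) fun x hx => hb x (.inr hx)]
  | neg φ ih => exact congrArg _ (ih hf hb)
  | know i φ ih => exact congrArg _ (ih hf hb)
  | every i φ ih => exact congrArg _ (ih hf hb)
  | common i φ ih => exact congrArg _ (ih hf hb)
  | prob i r φ ih => exact congrArg _ (ih hf hb)
  | everyP i r φ ih => exact congrArg _ (ih hf hb)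
  | commonP i r φ ih => exact congrArg _ (ih hf hb)

theorem cmap_id (φ : Formula A 𝒢) : φ.cmap id (fun k => .const k) = φ := by
  induction φ <;> simp_all [cmap, Term.cmap_id]

end Formula

end PCK

namespace PCK

universe u

open Function

/-! ## Derivations -/

namespace Formula

variable {A : Type u} {𝒢 : Set (Set A)} (e : Formula A 𝒢 → Prop) (φ ψ : Formula A 𝒢)

theorem propEval_neg : (neg φ).propEval e ↔ ¬ φ.propEval e := Iff.rfl

theorem propEval_and : (and φ ψ).propEval e ↔ φ.propEval e ∧ ψ.propEval e := Iff.rfl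

theorem propEval_imp : (imp φ ψ).propEval e ↔ (φ.propEval e → ψ.propEval e) := by
  simp only [imp, propEval_neg, propEval_and]; tauto

theorem propEval_or : (or φ ψ).propEval e ↔ φ.propEval e ∨ ψ.propEval e := by
  simp only [or, propEval_neg, propEval_and]; tauto

theorem propEval_bot : (bot : Formula A 𝒢).propEval e ↔ False := by
  simp only [bot, propEval_neg, propEval_and]; tauto

theorem propEval_top : (top : Formula A 𝒢).propEval e ↔ True := by
  simp only [top, propEval_neg, propEval_bot]; tauto

end Formula

theorem Q01.compl_compl (r : Q01) : r.compl.compl = r := Subtype.ext (by simp [Q01.compl])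

variable {A : Type u} {𝒢 : Set (Set A)} {T T' : Set (Formula A 𝒢)} {φ ψ χ ξ : Formula A 𝒢}

open Formula

namespace Derivable

theorem base (h : BaseSchema φ) : Derivable T φ := schema _ (.base _ h)

theorem of_taut (h : φ.IsTautology) : Derivable T φ := base (.taut _ h)

/-- Propositional steps are checked semantically, on truth values, instead of being derived. -/
theorem cons₁ (h : Derivable T φ) (t : ∀ e, φ.propEval e → ψ.propEval e) : Derivable T ψ :=
  mp _ _ h (of_taut fun e => (propEval_imp e _ _).2 (t e))

theorem cons₂ (h₁ : Derivable T φ) (h₂ : Derivable T ψ)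
    (t : ∀ e, φ.propEval e → ψ.propEval e → χ.propEval e) : Derivable T χ :=
  mp _ _ h₂ (h₁.cons₁ fun e h => (propEval_imp e _ _).2 (t e h))

theorem cons₃ (h₁ : Derivable T φ) (h₂ : Derivable T ψ) (h₃ : Derivable T χ)
    (t : ∀ e, φ.propEval e → ψ.propEval e → χ.propEval e → ξ.propEval e) : Derivable T ξ :=
  mp _ _ h₃ (h₁.cons₂ h₂ fun e h h' => (propEval_imp e _ _).2 (t e h h'))

theorem imp_trans (h₁ : Derivable T (φ.imp ψ)) (h₂ : Derivable T (ψ.imp χ)) :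
    Derivable T (φ.imp χ) :=
  h₁.cons₂ h₂ fun e => by simp only [propEval_imp]; tauto

theorem mono (h : Derivable T φ) (hT : T ⊆ T') : Derivable T' φ := by
  induction h with
  | schema φ h => exact schema _ h
  | hyp φ h => exact hyp _ (hT h)
  | mp φ ψ _ _ ih₁ ih₂ => exact mp _ _ (ih₁ hT) (ih₂ hT)
  | gen x φ _ ih => exact gen _ _ (ih hT)
  | rk i φ h _ => exact rk _ _ h
  | re k θ X G φ _ ih => exact re k θ X G φ fun i hi => ih i hi hT
  | rc k θ X G φ _ ih => exact rc k θ X G φ fun m hm => ih m hm hT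
  | ra k θ X i r hr φ _ ih => exact ra k θ X i r hr φ fun m q hm hq => ih m q hm hq hT
  | rpe k θ X G r φ _ ih => exact rpe k θ X G r φ fun i hi => ih i hi hT
  | rpc k θ X G r φ _ ih => exact rpc k θ X G r φ fun m => ih m hT

theorem weaken (h : Derivable ∅ φ) : Derivable T φ := h.mono (Set.empty_subset _)

/-- Hypotheses may be replaced by formulas from which they are derivable. -/
theorem of_forall_derivable (h : Derivable T φ) (hT : ∀ ψ ∈ T, Derivable T' ψ) :
    Derivable T' φ := by
  induction h with
  | schema φ h => exact schema _ h
  | hyp φ h => exact hT _ h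
  | mp φ ψ _ _ ih₁ ih₂ => exact mp _ _ (ih₁ hT) (ih₂ hT)
  | gen x φ _ ih => exact gen _ _ (ih hT)
  | rk i φ h _ => exact rk _ _ h
  | re k θ X G φ _ ih => exact re k θ X G φ fun i hi => ih i hi hT
  | rc k θ X G φ _ ih => exact rc k θ X G φ fun m hm => ih m hm hT
  | ra k θ X i r hr φ _ ih => exact ra k θ X i r hr φ fun m q hm hq => ih m q hm hq hT
  | rpe k θ X G r φ _ ih => exact rpe k θ X G r φ fun i hi => ih i hi hT
  | rpc k θ X G r φ _ ih => exact rpc k θ X G r φ fun m => ih m hT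

theorem all_of_imp {x : ℕ} (hx : x ∉ φ.fv) (h : Derivable T (φ.imp ψ)) :
    Derivable T (φ.imp (all x ψ)) := mp _ _ (gen x _ h) (base (.fo1 x φ ψ hx))

theorem all_imp_self (x : ℕ) (φ : Formula A 𝒢) : Derivable T ((all x φ).imp φ) := by
  have h : Derivable T ((all x φ).imp (φ.subst x (.var x))) := base (.fo2 x φ _ (freeFor_self x φ))
  rwa [subst_self] at h

/-- Necessitation for `P_{i,≥ 1}`, recovered from necessitation for `K_i` and CON. -/
theorem prob_one_of_thm (i : A) (h : Derivable ∅ φ) : Derivable T (prob i 1 φ) :=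
  mp _ _ (rk i φ h) (schema _ (.con i φ))

/-! ### Monotonicity of the operators -/

theorem know_imp_know (i : A) (φ ψ : Formula A 𝒢) :
    Derivable T ((know i (φ.imp ψ)).imp ((know i φ).imp (know i ψ))) :=
  (base (.ak i φ ψ)).cons₁ fun e => by simp only [propEval_imp, propEval_and]; tauto

theorem know_mono (i : A) (h : Derivable ∅ (φ.imp ψ)) :
    Derivable T ((know i φ).imp (know i ψ)) := mp _ _ (rk i _ h) (know_imp_know i φ ψ)

/-- Known implications are monotone for the probability operators. -/
theorem know_imp_prob (i : A) (r : Q01) (φ ψ : Formula A 𝒢) :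
    Derivable T ((know i (φ.imp ψ)).imp ((prob i r φ).imp (prob i r ψ))) := by
  have h₁ : Derivable T (prob i 1 (neg (and φ bot))) :=
    prob_one_of_thm i (of_taut fun e => by
      simp only [propEval_neg, propEval_and, propEval_bot]; tauto)
  have h₂ : Derivable T (prob i 0 bot) := base (.p1 i bot)
  -- Adding the disjoint `⊥` at threshold `0` turns `φ` into `φ ∨ ⊥`, which is by definition `¬(¬φ ∧
  -- ¬⊥)`.
  have h₃ : Derivable T ((and (and (prob i r φ) (prob i 0 bot))
      (prob i 1 (neg (and φ bot)))).imp (prob i r (φ.or bot))) :=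
    base (.p4 i r 0 r (by have := r.2.2; simp [this]) φ bot)
  have h₄ : Derivable T ((prob i r φ).imp (prob i r (φ.or bot))) :=
    h₁.cons₃ h₂ h₃ fun e => by simp only [propEval_imp, propEval_and]; tauto
  -- `P_{i,≥ r}` of that negation is literally `P_{i,≤ 1-r}(¬φ ∧ ¬⊥)`. Together with `P_{i,< r} ψ`
  -- the bounds add up to `1`, so `(¬φ ∧ ¬⊥) ∨ ψ` would have probability below `1`, against CON for
  -- the known implication.
  have h₅ : Derivable T ((and (probLe i r.compl (and (neg φ) (neg bot))) (probLt i r ψ)).imp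
      (probLt i 1 ((and (neg φ) (neg bot)).or ψ))) :=
    base (.p5 i r.compl r 1 (by simp [Q01.compl]) _ ψ)
  rw [probLe, Q01.compl_compl] at h₅
  have h₆ : Derivable T ((know i (φ.imp ψ)).imp (know i ((and (neg φ) (neg bot)).or ψ))) :=
    know_mono i (of_taut fun e => by
      simp only [propEval_imp, propEval_or, propEval_and, propEval_neg, propEval_bot]; tauto)
  have h₇ := h₆.imp_trans (schema _ (.con i _))
  exact h₄.cons₃ h₅ h₇ fun e => by
    simp only [propEval_imp, propEval_and, probLt, propEval_neg, Formula.or]; tauto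

theorem prob_mono (i : A) (r : Q01) (h : Derivable ∅ (φ.imp ψ)) :
    Derivable T ((prob i r φ).imp (prob i r ψ)) := mp _ _ (rk i _ h) (know_imp_prob i r φ ψ)

/-- The infinitary rule with `k = 0` and antecedent `E_G φ`. Nonemptiness of `G` only supplies an
agent to fill the irrelevant operator sequence. -/
theorem every_mono {G : 𝒢} (hG : G.1.Nonempty) (h : Derivable ∅ (φ.imp ψ)) :
    Derivable T ((every G φ).imp (every G ψ)) := by
  obtain ⟨j, -⟩ := hG
  exact re 0 (fun _ => every G φ) (fun _ => .know j) G ψ fun i hi =>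
    (base (.ae G i hi φ)).imp_trans (know_mono i h)

theorem everyPow_mono {G : 𝒢} (hG : G.1.Nonempty) (h : Derivable ∅ (φ.imp ψ)) (m : ℕ) :
    Derivable ∅ ((everyPow G m φ).imp (everyPow G m ψ)) := by
  induction m with
  | zero => exact h
  | succ m ih => exact every_mono hG ih

theorem common_mono {G : 𝒢} (hG : G.1.Nonempty) (h : Derivable ∅ (φ.imp ψ)) :
    Derivable T ((common G φ).imp (common G ψ)) := by
  have ⟨j, _⟩ := hG
  exact rc 0 (fun _ => common G φ) (fun _ => .know j) G ψ fun m hm =>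
    (base (.ac G m hm φ)).imp_trans (everyPow_mono hG h m).weaken

theorem everyP_mono {G : 𝒢} (hG : G.1.Nonempty) (r : Q01) (h : Derivable ∅ (φ.imp ψ)) :
    Derivable T ((everyP G r φ).imp (everyP G r ψ)) := by
  obtain ⟨j, -⟩ := hG
  exact rpe 0 (fun _ => everyP G r φ) (fun _ => .know j) G r ψ fun i hi =>
    (base (.ape G r i hi φ)).imp_trans (know_mono i (prob_mono i r h))

theorem fPow_mono {G : 𝒢} (hG : G.1.Nonempty) (r : Q01) (h : Derivable ∅ (φ.imp ψ)) (m : ℕ) :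
    Derivable ∅ ((fPow G r m φ).imp (fPow G r m ψ)) := by
  induction m with
  | zero => exact of_taut fun e => by simp only [propEval_imp, fPow]; tauto
  | succ m ih =>
    exact everyP_mono hG r (h.cons₂ ih fun e => by simp only [propEval_imp, propEval_and]; tauto)

theorem commonP_mono {G : 𝒢} (hG : G.1.Nonempty) (r : Q01) (h : Derivable ∅ (φ.imp ψ)) :
    Derivable T ((commonP G r φ).imp (commonP G r ψ)) := by
  have ⟨j, _⟩ := hG
  exact rpc 0 (fun _ => commonP G r φ) (fun _ => .know j) G r ψ fun m =>
    (base (.apc G r m φ)).imp_trans (fPow_mono hG r h m).weaken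

theorem all_mono (x : ℕ) (h : Derivable T (φ.imp ψ)) : Derivable T ((all x φ).imp (all x ψ)) :=
  all_of_imp (by simp [fv]) ((all_imp_self x φ).imp_trans h)

theorem all_imp_all_subst {x y : ℕ} (hf : y ∉ φ.fv) (hb : y ∉ φ.bv) :
    Derivable T ((all x φ).imp (all y (φ.subst x (.var y)))) :=
  all_of_imp (by simp [fv, hf]) (base (.fo2 x φ _ (freeFor_var_of_notMem hb)))

/-- Instantiating `y` by `x` gives back `φ`, and `x` is not free in the antecedent, so one may
generalize on it. -/
theorem all_subst_imp_all {x y : ℕ} (hf : y ∉ φ.fv) (hb : y ∉ φ.bv) :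
    Derivable T ((all y (φ.subst x (.var y))).imp (all x φ)) := by
  have h : Derivable T ((all y (φ.subst x (.var y))).imp _) :=
    base (.fo2 y _ (.var x) (freeFor_subst_var hf hb))
  rw [subst_subst_of_notMem hf hb] at h
  refine all_of_imp (fun hx => ?_) h
  simp only [fv, Finset.mem_erase] at hx
  rcases fv_subst hx.2 with h' | h'
  · exact h'.2 rfl
  · exact hx.1 (by simpa [Term.vars] using h')

end Derivable

/-! ### Renaming bound variables -/

/-- An even number above all elements of a finite set. -/
def freshEven (s : Finset ℕ) : ℕ := 2 * (s.sup id + 1)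

theorem freshEven_notMem (s : Finset ℕ) : freshEven s ∉ s := fun h => by
  have : freshEven s ≤ s.sup id := Finset.le_sup (f := id) h
  unfold freshEven at this
  omega

/-- Rename the bound variables so that all of them are even. -/
def Formula.evenBound : Formula A 𝒢 → Formula A 𝒢
  | rel m k ts => rel m k ts
  | neg φ => neg φ.evenBound
  | and φ ψ => and φ.evenBound ψ.evenBound
  | all x φ => all (freshEven (φ.evenBound.fv ∪ φ.evenBound.bv))
      (φ.evenBound.subst x (.var (freshEven (φ.evenBound.fv ∪ φ.evenBound.bv))))
  | know i φ => know i φ.evenBound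
  | every G φ => every G φ.evenBound
  | common G φ => common G φ.evenBound
  | prob i r φ => prob i r φ.evenBound
  | everyP G r φ => everyP G r φ.evenBound
  | commonP G r φ => commonP G r φ.evenBound

theorem Formula.even_of_mem_bv_evenBound {z : ℕ} (h : z ∈ φ.evenBound.bv) : Even z := by
  induction φ with
  | all x φ ih =>
    simp only [evenBound, bv, bv_subst, Finset.mem_insert] at h
    rcases h with h | h
    · exact h ▸ even_two_mul _
    · exact ih h
  | rel m k ts => simp [evenBound, bv] at h
  | and φ ψ ih₁ ih₂ =>
    simp only [evenBound, bv, Finset.mem_union] at h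
    exact h.elim ih₁ ih₂
  | _ => simp_all [evenBound, bv]

theorem Formula.fv_evenBound (φ : Formula A 𝒢) : φ.evenBound.fv ⊆ φ.fv := by
  induction φ with
  | all x φ ih =>
    intro z hz
    simp only [evenBound, fv, Finset.mem_erase] at hz ⊢
    rcases fv_subst hz.2 with h | h
    · exact ⟨h.2, ih h.1⟩
    · exact absurd (by simpa [Term.vars] using h) hz.1
  | rel m k ts => exact subset_rfl
  | and φ ψ ih₁ ih₂ => exact Finset.union_subset_union ih₁ ih₂
  | _ => simp_all [evenBound, fv]

/-- Both implications are carried together because negation exchanges them, and as theorems because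
monotonicity of the modal operators rests on necessitation. -/
theorem Formula.equiv_evenBound (h𝒢 : ∀ G ∈ 𝒢, G.Nonempty) (φ : Formula A 𝒢) :
    Derivable ∅ (φ.imp φ.evenBound) ∧ Derivable ∅ (φ.evenBound.imp φ) := by
  induction φ with
  | rel m k ts =>
    exact ⟨.of_taut fun e => by simp only [propEval_imp, evenBound]; tauto,
      .of_taut fun e => by simp only [propEval_imp, evenBound]; tauto⟩
  | neg φ ih =>
    exact ⟨ih.2.cons₁ fun e => by simp only [propEval_imp, evenBound, propEval_neg]; tauto,
      ih.1.cons₁ fun e => by simp only [propEval_imp, evenBound, propEval_neg]; tauto⟩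
  | and φ ψ ih₁ ih₂ =>
    exact ⟨ih₁.1.cons₂ ih₂.1 fun e => by simp only [propEval_imp, evenBound, propEval_and]; tauto,
      ih₁.2.cons₂ ih₂.2 fun e => by simp only [propEval_imp, evenBound, propEval_and]; tauto⟩
  | all x φ ih =>
    have h := freshEven_notMem (φ.evenBound.fv ∪ φ.evenBound.bv)
    simp only [Finset.mem_union, not_or] at h
    exact ⟨(Derivable.all_mono x ih.1).imp_trans (.all_imp_all_subst h.1 h.2),
      (Derivable.all_subst_imp_all h.1 h.2).imp_trans (.all_mono x ih.2)⟩
  | know i φ ih => exact ⟨.know_mono i ih.1, .know_mono i ih.2⟩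
  | every G φ ih => exact ⟨.every_mono (h𝒢 _ G.2) ih.1, .every_mono (h𝒢 _ G.2) ih.2⟩
  | common G φ ih => exact ⟨.common_mono (h𝒢 _ G.2) ih.1, .common_mono (h𝒢 _ G.2) ih.2⟩
  | prob i r φ ih => exact ⟨.prob_mono i r ih.1, .prob_mono i r ih.2⟩
  | everyP G r φ ih => exact ⟨.everyP_mono (h𝒢 _ G.2) r ih.1, .everyP_mono (h𝒢 _ G.2) r ih.2⟩
  | commonP G r φ ih =>
    exact ⟨.commonP_mono (h𝒢 _ G.2) r ih.1, .commonP_mono (h𝒢 _ G.2) r ih.2⟩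

/-! ### Renaming variables and constants in derivations -/

section

variable {ρ : ℕ → ℕ} {g : ℕ → Term}

theorem BaseSchema.cmap (hρ : Injective ρ) (hg : ∀ k x, ρ x ∉ (g k).vars) (h : BaseSchema φ) :
    BaseSchema (φ.cmap ρ g) := by
  cases h with
  | taut _ h => exact .taut _ fun e => (propEval_cmap ρ g e φ).2 (h _)
  | fo1 x φ ψ h => exact .fo1 _ _ _ (notMem_fv_cmap hρ hg h)
  | fo2 x φ t h =>
    rw [cmap_imp, cmap_subst hρ hg]
    exact .fo2 _ _ _ (freeFor_cmap hρ hg h)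
  | fo3 x i φ => exact .fo3 _ _ _
  | ak i φ ψ => exact .ak _ _ _
  | ae G i hi φ => exact .ae _ _ hi _
  | ac G m hm φ =>
    rw [cmap_imp, cmap_everyPow]
    exact .ac _ _ hm _
  | p1 i φ => exact .p1 _ _
  | p2 i r t h φ => exact .p2 _ _ _ h _
  | p3 i t φ => exact .p3 _ _ _
  | p4 i r t q h φ ψ => exact .p4 _ _ _ _ h _ _
  | p5 i r t q h φ ψ => exact .p5 _ _ _ _ h _ _
  | ape G r i hi φ => exact .ape _ _ _ hi _
  | apc G r m φ =>
    rw [cmap_imp, cmap_fPow]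
    exact .apc _ _ _ _

theorem Derivable.cmap (hρ : Injective ρ) (hg : ∀ k x, ρ x ∉ (g k).vars) (h : Derivable T φ) :
    Derivable (Formula.cmap ρ g '' T) (φ.cmap ρ g) := by
  induction h with
  | schema φ h =>
    cases h with
    | base _ h => exact base (h.cmap hρ hg)
    | con i φ => exact schema _ (.con _ _)
  | hyp φ h => exact hyp _ ⟨φ, h, rfl⟩
  | mp φ ψ _ _ ih₁ ih₂ => exact mp _ _ ih₁ ih₂
  | gen x φ _ ih => exact gen _ _ ih
  | rk i φ h ih =>
    -- The premise stays a theorem because the image of the empty set of hypotheses is empty.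
    rw [Set.image_empty] at ih
    exact rk _ _ ih
  | re k θ X G φ _ ih =>
    simp only [cmap_nested] at ih ⊢
    exact re _ _ _ _ _ ih
  | rc k θ X G φ _ ih =>
    simp only [cmap_nested, cmap_everyPow] at ih ⊢
    exact rc _ _ _ _ _ ih
  | ra k θ X i r hr φ _ ih =>
    simp only [cmap_nested] at ih ⊢
    exact ra _ _ _ _ _ hr _ ih
  | rpe k θ X G r φ _ ih =>
    simp only [cmap_nested] at ih ⊢
    exact rpe _ _ _ _ _ _ ih
  | rpc k θ X G r φ _ ih =>
    simp only [cmap_nested, cmap_fPow] at ih ⊢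
    exact rpc _ _ _ _ _ _ ih

end

end PCK

namespace PCK

universe u

open Function

/-! ## Countability of the language -/

/-- The tree of a term. -/
def Term.toW : Term → WType fun a : ℕ × ℕ × ℕ => Fin a.1
  -- The offset separates variables from constants, whose middle entry is `0`.
  | .var x => ⟨(0, x + 1, 0), Fin.elim0⟩
  | .func m k ts => ⟨(m, 0, k), fun j => (ts j).toW⟩

theorem Term.toW_injective : Injective Term.toW := by
  intro s
  induction s with
  | var x =>
    intro t h
    cases t <;> simp_all [toW]
  | func m k ts ih =>
    intro t h
    cases t with
    | var x => simp [toW] at h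
    | func m' k' ts' =>
      simp only [toW, WType.mk.injEq, Prod.mk.injEq, true_and] at h
      obtain ⟨⟨rfl, rfl⟩, h⟩ := h
      simp only [heq_eq_eq, func.injEq, true_and] at h ⊢
      exact funext fun j => ih j (congrFun h j)

instance Term.instCountable : Countable Term :=
  Term.toW_injective.countable

section Countable

variable {A : Type u} {𝒢 : Set (Set A)}

/-- The labels of the trees of formulas; the first component is the number of children. -/
abbrev FormulaLabel (A : Type u) (𝒢 : Set (Set A)) : Type u :=
  ℕ × ℕ × Option (Σ m : ℕ, ℕ × (Fin m → Term)) × Option A × Option 𝒢 × Option Q01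

/-- The tree of a formula. -/
def Formula.toW : Formula A 𝒢 → WType fun a : FormulaLabel A 𝒢 => Fin a.1
  | rel m k ts => ⟨(0, 0, some ⟨m, k, ts⟩, none, none, none), Fin.elim0⟩
  | neg φ => ⟨(1, 0, none, none, none, none), fun _ => φ.toW⟩
  | and φ ψ => ⟨(2, 0, none, none, none, none), ![φ.toW, ψ.toW]⟩
  -- The offset avoids the tags `0`, `1`, `2` of the other unary constructors.
  | all x φ => ⟨(1, x + 3, none, none, none, none), fun _ => φ.toW⟩
  | know i φ => ⟨(1, 0, none, some i, none, none), fun _ => φ.toW⟩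
  | every G φ => ⟨(1, 1, none, none, some G, none), fun _ => φ.toW⟩
  | common G φ => ⟨(1, 2, none, none, some G, none), fun _ => φ.toW⟩
  | prob i r φ => ⟨(1, 0, none, some i, none, some r), fun _ => φ.toW⟩
  | everyP G r φ => ⟨(1, 1, none, none, some G, some r), fun _ => φ.toW⟩
  | commonP G r φ => ⟨(1, 2, none, none, some G, some r), fun _ => φ.toW⟩

theorem Formula.toW_injective : Injective (Formula.toW : Formula A 𝒢 → _) := by
  intro φ
  induction φ with
  | rel m k ts =>
    intro ψ h
    cases ψ with
    | rel m' k' ts' =>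
      simp only [toW, WType.mk.injEq, Prod.mk.injEq, Option.some.injEq, Sigma.mk.injEq, true_and,
        and_true] at h
      obtain ⟨⟨rfl, h⟩, -⟩ := h
      obtain ⟨rfl, rfl⟩ := Prod.mk.inj (eq_of_heq h)
      rfl
    | _ => simp [toW] at h
  | and φ φ' ih ih' =>
    intro ψ h
    cases ψ with
    | and ψ ψ' =>
      simp only [toW, WType.mk.injEq, heq_eq_eq, true_and] at h
      rw [ih (congrFun h 0), ih' (congrFun h 1)]
    | _ => simp [toW] at h
  | neg φ ih =>
    intro ψ h
    cases ψ with
    | neg ψ =>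
      simp only [toW, WType.mk.injEq, heq_eq_eq, true_and] at h
      rw [ih (congrFun h 0)]
    | _ => simp [toW] at h
  | all x φ ih =>
    intro ψ h
    cases ψ with
    | all y ψ =>
      simp only [toW, WType.mk.injEq, Prod.mk.injEq, add_left_inj, and_true, true_and] at h
      obtain ⟨rfl, h⟩ := h
      rw [ih (congrFun (eq_of_heq h) 0)]
    | _ => simp [toW] at h
  | know i φ ih | every i φ ih | common i φ ih =>
    intro ψ h
    cases ψ with
    | know j ψ | every j ψ | common j ψ =>
      simp [toW] at h
      try obtain ⟨rfl, h⟩ := h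
      try rw [ih (congrFun h 0)]
    | _ => simp [toW] at h
  | prob i r φ ih | everyP i r φ ih | commonP i r φ ih =>
    intro ψ h
    cases ψ with
    | prob j q ψ | everyP j q ψ | commonP j q ψ =>
      simp [toW] at h
      try obtain ⟨⟨rfl, rfl⟩, h⟩ := h
      try rw [ih (congrFun h 0)]
    | _ => simp [toW] at h

theorem Formula.countable [Countable A] (h𝒢 : 𝒢.Countable) : Countable (Formula A 𝒢) := by
  have : Countable 𝒢 := h𝒢
  let := Encodable.ofCountable (FormulaLabel A 𝒢)
  exact Formula.toW_injective.countable

theorem NestOp.countable [Countable A] : Countable (NestOp A) := by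
  have : Injective fun X : NestOp A => match X with
      | .know i => (Sum.inl i : A ⊕ A)
      | .probOne i => Sum.inr i := by
    rintro (i | i) (j | j) h <;> simp_all
  exact this.countable

theorem nested_congr {θ θ' : ℕ → Formula A 𝒢} {X X' : ℕ → NestOp A} {k : ℕ}
    (hθ : ∀ j ≤ k, θ j = θ' j) (hX : ∀ j ≤ k, X j = X' j) :
    nested θ X k = nested θ' X' k := by
  induction k with
  | zero => funext τ; simp [nested, hθ 0 le_rfl]
  | succ k ih =>
    funext τ
    simp only [nested, hθ _ le_rfl, hX _ le_rfl,
      ih (fun j hj => hθ j (hj.trans k.le_succ)) fun j hj => hX j (hj.trans k.le_succ)]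

/-- The sequences `θ` and `X` form uncountable types, but a nested implication depends on only
finitely many entries, so the resulting contexts can be counted by recursion on `k`. -/
theorem countable_range_nested [Countable A] (h𝒢 : 𝒢.Countable) :
    {f : Formula A 𝒢 → Formula A 𝒢 | ∃ k θ X, f = nested θ X k}.Countable := by
  have := Formula.countable h𝒢
  have := NestOp.countable (A := A)
  have h : ∀ k, {f : Formula A 𝒢 → Formula A 𝒢 | ∃ θ X, f = nested θ X k}.Countable := by
    intro k
    induction k with
    | zero =>
      refine (Set.countable_range fun φ : Formula A 𝒢 => φ.imp).mono ?_
      rintro f ⟨θ, X, rfl⟩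
      exact ⟨θ 0, rfl⟩
    | succ k ih =>
      have := ih.to_subtype
      refine (Set.countable_range fun p : Formula A 𝒢 × NestOp A ×
        {f : Formula A 𝒢 → Formula A 𝒢 | ∃ θ X, f = nested θ X k} =>
        fun τ => p.1.imp (p.2.1.app (p.2.2.1 τ))).mono ?_
      rintro f ⟨θ, X, rfl⟩
      exact ⟨(θ (k + 1), X (k + 1), ⟨nested θ X k, θ, X, rfl⟩), rfl⟩
  refine (Set.countable_iUnion h).mono ?_
  rintro f ⟨k, hk⟩
  exact Set.mem_iUnion.2 ⟨k, hk⟩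

end Countable

/-! ## Saturated theories -/

variable {A : Type u} {𝒢 : Set (Set A)}

open Formula

/-- The premises from which the infinitary rules infer a formula, without the nesting. -/
def Formula.premises : Formula A 𝒢 → Set (Formula A 𝒢)
  | every G φ => {p | ∃ i ∈ G.1, p = know i φ}
  | common G φ => {p | ∃ m : ℕ, 1 ≤ m ∧ p = everyPow G m φ}
  | prob i r φ => {p | ∃ (m : ℕ) (q : Q01), 1 / (r : ℚ) ≤ (m : ℚ) ∧
      (q : ℚ) = (r : ℚ) - 1 / (m : ℚ) ∧ p = prob i q φ}
  | everyP G r φ => {p | ∃ i ∈ G.1, p = knowP i r φ}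
  | commonP G r φ => {p | ∃ m : ℕ, p = fPow G r m φ}
  | φ => {φ}

theorem Formula.isSentence_of_mem_premises {φ p : Formula A 𝒢} (hφ : φ.IsSentence)
    (hp : p ∈ φ.premises) : p.IsSentence := by
  cases φ with
  | every G φ => obtain ⟨i, -, rfl⟩ := hp; exact hφ
  | common G φ => obtain ⟨m, -, rfl⟩ := hp; exact isSentence_everyPow.2 hφ
  | prob i r φ => obtain ⟨m, q, -, -, rfl⟩ := hp; exact hφ
  | everyP G r φ => obtain ⟨i, -, rfl⟩ := hp; exact hφ
  | commonP G r φ => obtain ⟨m, rfl⟩ := hp; exact isSentence_fPow (isSentence_commonP.1 hφ) m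
  | _ => cases hp; exact hφ

/-- This puts the five infinitary rules into one form; for other formulas the only premise is the
conclusion itself. -/
theorem Derivable.nested_of_premises {T : Set (Formula A 𝒢)} {θ : ℕ → Formula A 𝒢}
    {X : ℕ → NestOp A} {k : ℕ} {τ : Formula A 𝒢}
    (h : ∀ p ∈ τ.premises, Derivable T (nested θ X k p)) : Derivable T (nested θ X k τ) := by
  cases τ with
  | every G φ => exact re _ _ _ _ _ fun i hi => h _ ⟨i, hi, rfl⟩
  | common G φ => exact rc _ _ _ _ _ fun m hm => h _ ⟨m, hm, rfl⟩
  | prob i r φ =>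
    by_cases hr : 0 < r
    · exact ra _ _ _ _ _ hr _ fun m q hm hq => h _ ⟨m, q, hm, hq, rfl⟩
    · have : r = 0 := le_antisymm (not_lt.1 hr) r.2.1
      subst this
      -- For `r = 0` the convention `1 / 0 = 0` admits `m = 0` and `q = 0`, so the conclusion is
      -- among its own premises.
      exact h _ ⟨0, 0, by simp, by simp, rfl⟩
  | everyP G r φ => exact rpe _ _ _ _ _ _ fun i hi => h _ ⟨i, hi, rfl⟩
  | commonP G r φ => exact rpc _ _ _ _ _ _ fun m => h _ ⟨m, rfl⟩
  | _ => exact h _ rfl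

theorem isSentence_nested_of_imp {θ : ℕ → Formula A 𝒢} {X : ℕ → NestOp A} {k : ℕ}
    {τ p : Formula A 𝒢} (h : (nested θ X k τ).IsSentence)
    (hp : τ.IsSentence → p.IsSentence) : (nested θ X k p).IsSentence := by
  induction k with
  | zero => simp_all [nested]
  | succ k ih => simp_all [nested]

/-- Sets of sentences that contain the theorems and are closed under modus ponens, the infinitary
rules, and the rule that infers `∀ x φ` from its closed instances. -/
structure IsTheory (F : Set (Formula A 𝒢)) : Prop where
  isSentence : ∀ {φ}, φ ∈ F → φ.IsSentence
  thm : ∀ {φ}, Derivable ∅ φ → φ.IsSentence → φ ∈ F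
  mp : ∀ {φ ψ}, φ ∈ F → φ.imp ψ ∈ F → ψ ∈ F
  omega : ∀ {x φ}, (all x φ).IsSentence →
    (∀ t : Term, t.vars = ∅ → φ.subst x t ∈ F) → all x φ ∈ F
  infer : ∀ {k θ X τ}, (nested θ X k τ).IsSentence →
    (∀ p ∈ premises τ, nested θ X k p ∈ F) → nested θ X k τ ∈ F

namespace IsTheory

variable {F : Set (Formula A 𝒢)} {φ ψ χ ξ : Formula A 𝒢}

theorem taut (hF : IsTheory F) (hφ : φ.IsSentence) (t : φ.IsTautology) : φ ∈ F :=
  hF.thm (.of_taut t) hφ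

theorem cons₁ (hF : IsTheory F) (h : φ ∈ F) (hψ : ψ.IsSentence)
    (t : ∀ e, φ.propEval e → ψ.propEval e) : ψ ∈ F :=
  hF.mp h (hF.taut (isSentence_imp.2 ⟨hF.isSentence h, hψ⟩) fun e => (propEval_imp e _ _).2 (t e))

theorem cons₂ (hF : IsTheory F) (h₁ : φ ∈ F) (h₂ : ψ ∈ F) (hχ : χ.IsSentence)
    (t : ∀ e, φ.propEval e → ψ.propEval e → χ.propEval e) : χ ∈ F :=
  hF.mp h₂ (hF.cons₁ h₁ (isSentence_imp.2 ⟨hF.isSentence h₂, hχ⟩) fun e h =>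
    (propEval_imp e _ _).2 (t e h))

theorem imp_trans (hF : IsTheory F) (h₁ : φ.imp ψ ∈ F) (h₂ : ψ.imp χ ∈ F) : φ.imp χ ∈ F :=
  hF.cons₂ h₁ h₂
    (isSentence_imp.2 ⟨(isSentence_imp.1 (hF.isSentence h₁)).1,
      (isSentence_imp.1 (hF.isSentence h₂)).2⟩)
    fun e => by simp only [propEval_imp]; tauto

/-- The infinitary rules are also admissible under an additional hypothesis. -/
theorem imp_infer (hF : IsTheory F) (hχ : χ.IsSentence) {k : ℕ} {θ : ℕ → Formula A 𝒢}
    {X : ℕ → NestOp A} {τ : Formula A 𝒢} (hτ : (nested θ X k τ).IsSentence)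
    (h : ∀ p ∈ premises τ, χ.imp (nested θ X k p) ∈ F) : χ.imp (nested θ X k τ) ∈ F := by
  -- Split off the outermost antecedent `α`. Replacing it by `χ ∧ α` is again a nested implication
  -- and is propositionally the same as adding the hypothesis `χ`.
  obtain ⟨α, ψ, h₁, h₂⟩ : ∃ (α : Formula A 𝒢) (ψ : Formula A 𝒢 → Formula A 𝒢),
      (∀ τ, nested θ X k τ = α.imp (ψ τ)) ∧
      ∀ τ, nested (update θ k (and χ α)) X k τ = (and χ α).imp (ψ τ) := by
    cases k with
    | zero => exact ⟨θ 0, id, fun τ => rfl, fun τ => by simp [nested]⟩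
    | succ k =>
      refine ⟨θ (k + 1), fun τ => (X (k + 1)).app (nested θ X k τ), fun τ => rfl, fun τ => ?_⟩
      rw [nested, update_self, nested_congr (X' := X) (fun j hj => ?_) fun _ _ => rfl]
      exact update_of_ne (by omega) _ _
  simp only [h₁, isSentence_imp] at hτ h ⊢
  refine hF.cons₁ (φ := (and χ α).imp (ψ τ)) ?_ (by simp [hτ, hχ]) fun e => by
    simp only [propEval_imp, propEval_and]; tauto
  rw [← h₂]
  refine hF.infer (by simp [h₂, hτ, hχ]) fun p hp => ?_
  rw [h₂]
  have hs := hF.isSentence (h p hp)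
  simp only [isSentence_imp] at hs
  exact hF.cons₁ (h p hp) (by simp [hs]) fun e => by
    simp only [propEval_imp, propEval_and]; tauto

theorem imp_omega (hF : IsTheory F) (hχ : χ.IsSentence) {x : ℕ} (hφ : (all x φ).IsSentence)
    (h : ∀ t : Term, t.vars = ∅ → χ.imp (φ.subst x t) ∈ F) : χ.imp (all x φ) ∈ F := by
  have hx : x ∉ χ.fv := by rw [show χ.fv = ∅ from hχ]; simp
  have hs : (all x (χ.imp φ)).IsSentence := by
    rw [isSentence_all] at hφ ⊢
    intro z hz
    have : χ.fv = ∅ := hχ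
    simp only [imp, fv, this, Finset.empty_union] at hz
    exact hφ z hz
  refine hF.mp (hF.omega hs fun t ht => ?_)
    (hF.thm (.base (.fo1 x χ φ hx)) (by simp [hs, hχ, hφ]))
  have := h t ht
  -- As `χ` is closed, `χ → φ(t)` is an instance of `χ → φ`.
  rwa [← subst_of_notMem (t := t) hx] at this

/-- A chain of sentences that are consistent with the theory and decide countably many
requirements. -/
theorem exists_chain (hF : IsTheory F) (R : ℕ → Formula A 𝒢 × Set (Formula A 𝒢))
    (hs : ∀ n, (R n).1.IsSentence) (hs' : ∀ n, ∀ p ∈ (R n).2, p.IsSentence)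
    (hR : ∀ (n : ℕ) (χ : Formula A 𝒢), χ.IsSentence → (∀ p ∈ (R n).2, χ.imp p ∈ F) → χ.imp (R n).1 ∈ F)
    (hχ : χ.IsSentence) (hχF : neg χ ∉ F) :
    ∃ c : ℕ → Formula A 𝒢, c 0 = χ ∧ (∀ n, (c n).IsSentence ∧ neg (c n) ∉ F) ∧
      (∀ n, (c (n + 1)).imp (c n) ∈ F) ∧
      ∀ n, (c (n + 1)).imp (R n).1 ∈ F ∨ ∃ p ∈ (R n).2, (c (n + 1)).imp (neg p) ∈ F := by
  have step : ∀ (n : ℕ) (χ : {χ : Formula A 𝒢 // χ.IsSentence ∧ neg χ ∉ F}),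
      ∃ χ' : {χ : Formula A 𝒢 // χ.IsSentence ∧ neg χ ∉ F}, χ'.1.imp χ.1 ∈ F ∧
        (χ'.1.imp (R n).1 ∈ F ∨ ∃ p ∈ (R n).2, χ'.1.imp (neg p) ∈ F) := by
    rintro n ⟨χ, hχ, hχF⟩
    by_cases h : neg (and χ (R n).1) ∈ F
    -- If the conclusion cannot be added, then `χ` cannot imply it over `F`, so by `hR` some premise
    -- is not implied either, and its negation can be added.
    · have : χ.imp (R n).1 ∉ F := fun h' => hχF <| hF.cons₂ h h' hχ fun e => by
        simp only [propEval_imp, propEval_and, propEval_neg]; tauto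
      obtain ⟨p, hp, hpF⟩ : ∃ p ∈ (R n).2, χ.imp p ∉ F := by
        by_contra! hc
        exact this (hR n χ hχ hc)
      -- `hpF` fits because `¬(χ ∧ ¬p)` is by definition `χ → p`.
      refine ⟨⟨and χ (neg p), by simp [hχ, hs' n p hp], hpF⟩,
        hF.taut (by simp [hχ, hs' n p hp]) fun e => ?_,
        .inr ⟨p, hp, hF.taut (by simp [hχ, hs' n p hp]) fun e => ?_⟩⟩
      · simp only [propEval_imp, propEval_and]; tauto
      · simp only [propEval_imp, propEval_and]; tauto
    · refine ⟨⟨and χ (R n).1, by simp [hχ, hs n], h⟩, hF.taut (by simp [hχ, hs n]) fun e => ?_,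
        .inl (hF.taut (by simp [hχ, hs n]) fun e => ?_)⟩
      · simp only [propEval_imp, propEval_and]; tauto
      · simp only [propEval_imp, propEval_and]; tauto
  choose f hf hf' using step
  let c : ℕ → {χ : Formula A 𝒢 // χ.IsSentence ∧ neg χ ∉ F} := fun n =>
    Nat.rec ⟨χ, hχ, hχF⟩ f n
  exact ⟨fun n => (c n).1, rfl, fun n => (c n).2, fun n => hf n (c n), fun n => hf' n (c n)⟩

end IsTheory

/-- Maximal consistent saturated sets of sentences. -/
structure IsState (s : Set (Formula A 𝒢)) : Prop extends IsTheory s where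
  bot_notMem : bot ∉ s
  complete : ∀ {φ}, φ.IsSentence → φ ∈ s ∨ neg φ ∈ s

/-- The Lindenbaum lemma. -/
theorem IsTheory.exists_isState [Countable A] (h𝒢 : 𝒢.Countable) {F : Set (Formula A 𝒢)}
    (hF : IsTheory F) {χ : Formula A 𝒢} (hχ : χ.IsSentence) (hχF : neg χ ∉ F) :
    ∃ s, IsState s ∧ F ⊆ s ∧ χ ∈ s := by
  have := Formula.countable h𝒢
  have := (countable_range_nested h𝒢).to_subtype
  let N := {f : Formula A 𝒢 → Formula A 𝒢 | ∃ k θ X, f = nested θ X k}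
  -- Three kinds of requirements: decide a sentence, respect the ω-rule at a universal sentence,
  -- respect an infinitary rule in a given nesting.
  let ι := {φ : Formula A 𝒢 // φ.IsSentence} ⊕
    {p : ℕ × Formula A 𝒢 // (all p.1 p.2).IsSentence} ⊕
    {p : N × Formula A 𝒢 // (p.1.1 p.2).IsSentence}
  let r : ι → Formula A 𝒢 × Set (Formula A 𝒢) := Sum.elim (fun φ => (φ.1, {φ.1})) <|
    Sum.elim (fun p => (all p.1.1 p.1.2, {ψ | ∃ t : Term, t.vars = ∅ ∧ ψ = p.1.2.subst p.1.1 t}))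
      fun p => (p.1.1.1 p.1.2, p.1.1.1 '' p.1.2.premises)
  have : Nonempty ι := ⟨.inl ⟨χ, hχ⟩⟩
  obtain ⟨en, hen⟩ := exists_surjective_nat ι
  have h₁ : ∀ n, (r (en n)).1.IsSentence := by
    intro n
    rcases en n with φ | p | p
    exacts [φ.2, p.2, p.2]
  have h₂ : ∀ n, ∀ p ∈ (r (en n)).2, p.IsSentence := by
    intro n
    rcases en n with φ | p | ⟨⟨⟨-, k, θ, X, rfl⟩, τ⟩, hτ⟩
    · rintro p rfl
      exact φ.2
    · rintro q ⟨t, ht, rfl⟩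
      exact isSentence_subst p.2 ht
    · rintro - ⟨p, hp, rfl⟩
      exact isSentence_nested_of_imp hτ fun h => isSentence_of_mem_premises h hp
  have h₃ : ∀ (n : ℕ) (χ : Formula A 𝒢), χ.IsSentence → (∀ p ∈ (r (en n)).2, χ.imp p ∈ F) →
      χ.imp (r (en n)).1 ∈ F := by
    intro n
    rcases en n with φ | p | ⟨⟨⟨-, k, θ, X, rfl⟩, τ⟩, hτ⟩
    · exact fun χ _ h => h _ rfl
    · exact fun χ hχ h => hF.imp_omega hχ p.2 fun t ht => h _ ⟨t, ht, rfl⟩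
    · exact fun χ hχ h => hF.imp_infer hχ hτ fun p hp => h _ ⟨p, hp, rfl⟩
  obtain ⟨c, hc₀, hc, hmono, hdec⟩ := hF.exists_chain (fun n => r (en n)) h₁ h₂ h₃ hχ hχF
  have hle : ∀ m n, m ≤ n → (c n).imp (c m) ∈ F := fun m n h => by
    induction h with
    | refl =>
      exact hF.taut (by simp [(hc m).1]) fun e => by simp only [propEval_imp]; tauto
    | step _ ih => exact hF.imp_trans (hmono _) ih
  let s : Set (Formula A 𝒢) := {φ | ∃ n, (c n).imp φ ∈ F}
  have hs : ∀ {φ}, φ ∈ s → φ.IsSentence := fun ⟨n, h⟩ => (isSentence_imp.1 (hF.isSentence h)).2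
  have hFs : F ⊆ s := fun φ hφ => ⟨0, hF.cons₁ hφ (by simp [(hc 0).1, hF.isSentence hφ]) fun e => by
    simp only [propEval_imp]; tauto⟩
  have hmp : ∀ {φ ψ}, φ ∈ s → φ.imp ψ ∈ s → ψ ∈ s := by
    rintro φ ψ ⟨m, hm⟩ ⟨n, hn⟩
    have hm' := hF.imp_trans (hle m _ (le_max_left m n)) hm
    have hn' := hF.imp_trans (hle n _ (le_max_right m n)) hn
    have h := hF.isSentence hn'
    simp only [isSentence_imp] at h
    exact ⟨max m n, hF.cons₂ hm' hn' (by simp [h]) fun e => by simp only [propEval_imp]; tauto⟩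
  have hbot : bot ∉ s := fun ⟨n, hn⟩ => (hc n).2 <| hF.cons₁ hn (hc n).1 fun e => by
    simp only [propEval_imp, propEval_neg, propEval_bot]; tauto
  have hcon : ∀ {φ}, φ ∈ s → neg φ ∈ s → False := fun {φ} h h' => hbot <| hmp h <| hmp h' <|
    hFs <| hF.taut (by simp [hs h]) fun e => by
      simp only [propEval_imp, propEval_neg, propEval_bot]; tauto
  -- The chain put into `s` either the conclusion or the negation of a premise; the latter is
  -- excluded when all premises lie in `s`.
  have hreq : ∀ a : ι, (∀ p ∈ (r a).2, p ∈ s) → (r a).1 ∈ s := fun a h => by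
    obtain ⟨n, rfl⟩ := hen a
    rcases hdec n with h' | ⟨p, hp, h'⟩
    · exact ⟨_, h'⟩
    · exact (hcon (h p hp) ⟨_, h'⟩).elim
  refine ⟨s, ⟨⟨hs, fun h h' => hFs (hF.thm h h'), hmp, ?_, ?_⟩, hbot, ?_⟩, hFs, ?_⟩
  · intro x φ hφ h
    refine hreq (.inr (.inl ⟨(x, φ), hφ⟩)) ?_
    rintro p ⟨t, ht, rfl⟩
    exact h t ht
  · intro k θ X τ hτ h
    refine hreq (.inr (.inr ⟨(⟨nested θ X k, k, θ, X, rfl⟩, τ), hτ⟩)) ?_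
    rintro - ⟨p, hp, rfl⟩
    exact h p hp
  · intro φ hφ
    obtain ⟨n, hn⟩ := hen (.inl ⟨φ, hφ⟩)
    have := hdec n
    rw [hn] at this
    rcases this with h' | ⟨p, hp, h'⟩
    · exact .inl ⟨_, h'⟩
    · obtain rfl : p = φ := hp
      exact .inr ⟨_, h'⟩
  · exact ⟨0, hc₀ ▸ hle 0 0 le_rfl⟩

/-! ## The theory of the consequences of a set that omits many variables and constants -/

theorem Term.eventually_cmap_eq (s : Term) : ∀ᶠ c in Filter.atTop, ∀ g : ℕ → Term,
    (∀ k, k ≠ c → g k = .const k) → s.cmap id g = s := by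
  induction s with
  | var x => exact .of_forall fun c g _ => rfl
  | func m k ts ih =>
    filter_upwards [Filter.eventually_all.2 ih, Filter.eventually_gt_atTop k] with c hc hk g hg
    unfold cmap
    split_ifs with e
    · subst e
      rw [hg k hk.ne]
      exact congrArg _ (funext fun j => j.elim0)
    · exact congrArg _ (funext fun j => hc j g hg)

/-- All but finitely many constants do not occur in a given formula. -/
theorem Formula.eventually_cmap_eq (φ : Formula A 𝒢) : ∀ᶠ c in Filter.atTop, ∀ g : ℕ → Term,
    (∀ k, k ≠ c → g k = .const k) → φ.cmap id g = φ := by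
  induction φ with
  | rel m k ts =>
    filter_upwards [Filter.eventually_all.2 fun j => (ts j).eventually_cmap_eq] with c hc g hg
    exact congrArg _ (funext fun j => hc j g hg)
  | and φ ψ ih₁ ih₂ =>
    filter_upwards [ih₁, ih₂] with c h₁ h₂ g hg
    rw [cmap, h₁ g hg, h₂ g hg]
  | neg φ ih | all _ φ ih | know _ φ ih | every _ φ ih | common _ φ ih | prob _ _ φ ih
  | everyP _ _ φ ih | commonP _ _ φ ih =>
    filter_upwards [ih] with c hc g hg
    rw [cmap, hc g hg]
    try rfl

/-- Replace the `k`-th constant by the `2 k`-th. -/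
abbrev Formula.doubleConst (φ : Formula A 𝒢) : Formula A 𝒢 := φ.cmap id fun k => .const (2 * k)

/-- Generalization on a constant that does not occur in the hypotheses. -/
theorem Derivable.all_of_closed {S : Set (Formula A 𝒢)} (hf : ∀ φ ∈ S, ∀ z ∈ φ.fv, Even z)
    (hb : ∀ φ ∈ S, ∀ z ∈ φ.bv, Even z) {x : ℕ} {ψ : Formula A 𝒢}
    (h : ∀ t : Term, t.vars = ∅ → Derivable (doubleConst '' S) (ψ.subst x t)) :
    Derivable (doubleConst '' S) (all x ψ) := by
  -- An odd index does not occur in the doubled hypotheses, and a large one does not occur in `ψ`.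
  obtain ⟨c, hodd, hc⟩ : ∃ c, Odd c ∧ ∀ g : ℕ → Term,
      (∀ k, k ≠ c → g k = .const k) → ψ.cmap id g = ψ := by
    obtain ⟨N, hN⟩ := Filter.eventually_atTop.1 ψ.eventually_cmap_eq
    exact ⟨2 * N + 1, ⟨N, rfl⟩, hN _ (by omega)⟩
  obtain ⟨y, hyodd, hy⟩ : ∃ y, Odd y ∧ ∀ z ∈ insert x (ψ.fv ∪ ψ.bv), z < y := by
    refine ⟨2 * (insert x (ψ.fv ∪ ψ.bv)).sup id + 1, ⟨_, rfl⟩, fun z hz => ?_⟩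
    have : z ≤ (insert x (ψ.fv ∪ ψ.bv)).sup id := Finset.le_sup (f := id) hz
    omega
  -- Only odd variables from `y` on are moved. This vacates `y` for the constant `c`, even if the
  -- derivation uses all variables, and fixes the hypotheses, `x` and `ψ`.
  let ρ : ℕ → ℕ := fun n => if Even n ∨ n < y then n else n + 2
  let g : ℕ → Term := fun k => if k = c then .var y else .const k
  have hρ : Injective ρ := by
    intro m n hmn
    simp only [ρ, Nat.even_iff] at hmn
    split_ifs at hmn <;> omega
  have hg : ∀ k z, ρ z ∉ (g k).vars := by
    intro k z
    by_cases e : k = c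
    · simp only [g, e, if_true, Term.vars, Finset.mem_singleton, ρ]
      rw [Nat.odd_iff] at hyodd
      simp only [Nat.even_iff]
      split_ifs <;> omega
    · simp [g, e, Term.vars_const]
  have hρz : ∀ z, Even z ∨ z < y → ρ z = z := fun z hz => by simp [ρ, hz]
  have hT : Formula.cmap ρ g '' (doubleConst '' S) = doubleConst '' S := by
    rw [Set.image_image]
    refine Set.image_congr fun φ hφ => ?_
    refine cmap_cmap_eq_cmap (fun z hz => hρz z (.inl (hf φ hφ z hz)))
      (fun z hz => hρz z (.inl (hb φ hφ z hz))) fun k => ?_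
    have : 2 * k ≠ c := by rw [Nat.odd_iff] at hodd; omega
    simp [Term.cmap, g, this]
  have hψ : ψ.cmap ρ g = ψ := by
    have h₁ : (ψ.cmap id fun k => .const k).cmap ρ g = ψ.cmap id g :=
      cmap_cmap_eq_cmap (fun z hz => hρz z (.inr (hy z (by simp [hz]))))
        (fun z hz => hρz z (.inr (hy z (by simp [hz])))) fun k => by simp [Term.cmap]
    rw [cmap_id] at h₁
    rw [h₁]
    exact hc g fun k hk => by simp [g, hk]
  have h₁ := (h (.const c) (Term.vars_const c)).cmap hρ hg
  rw [hT, cmap_subst hρ hg, hψ, hρz x (.inr (hy x (by simp)))] at h₁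
  have h₂ : (Term.const c).cmap ρ g = .var y := by simp [Term.cmap, g]
  rw [h₂] at h₁
  have hyf : y ∉ ψ.fv := fun h => (hy y (by simp [h])).false
  have hyb : y ∉ ψ.bv := fun h => (hy y (by simp [h])).false
  exact mp _ _ (gen y _ h₁) (all_subst_imp_all hyf hyb)

theorem isTheory_setOf_derivable {S : Set (Formula A 𝒢)} (hf : ∀ φ ∈ S, ∀ z ∈ φ.fv, Even z)
    (hb : ∀ φ ∈ S, ∀ z ∈ φ.bv, Even z) :
    IsTheory {φ | φ.IsSentence ∧ Derivable (doubleConst '' S) φ} where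
  isSentence h := h.1
  thm h h' := ⟨h', h.weaken⟩
  mp h h' := ⟨(isSentence_imp.1 h'.1).2, .mp _ _ h.2 h'.2⟩
  omega h h' := ⟨h, .all_of_closed hf hb fun t ht => (h' t ht).2⟩
  infer h h' := ⟨h, .nested_of_premises fun p hp => (h' p hp).2⟩

/-- A consistent theory is contained in a state, up to a renaming of constants. -/
theorem Consistent.exists_isState [Countable A] (h𝒢 : 𝒢.Countable) (h𝒢ne : ∀ G ∈ 𝒢, G.Nonempty)
    {T : Set (Formula A 𝒢)} (hT : ∀ φ ∈ T, φ.IsSentence) (hcons : Consistent T) :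
    ∃ s : Set (Formula A 𝒢), IsState s ∧ ∀ φ ∈ T, doubleConst φ ∈ s := by
  have hinj : Injective (id : ℕ → ℕ) := injective_id
  have hconst : ∀ (f : ℕ → ℕ) (k x : ℕ), id x ∉ (Term.const (f k)).vars := fun f k x => by
    simp [Term.vars_const]
  have hsent : ∀ φ : Formula A 𝒢, φ.IsSentence → φ.doubleConst.IsSentence := fun φ hφ => by
    refine Finset.eq_empty_iff_forall_notMem.2 fun z hz => ?_
    rcases fv_cmap hz with ⟨x, hx, -⟩ | ⟨k, hk⟩
    · simp [show φ.fv = ∅ from hφ] at hx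
    · simp [Term.vars_const] at hk
  have hF := isTheory_setOf_derivable (S := evenBound '' T)
    (by
      rintro - ⟨φ, hφ, rfl⟩ z hz
      have := fv_evenBound φ hz
      simp [show φ.fv = ∅ from hT φ hφ] at this)
    (by
      rintro - ⟨φ, hφ, rfl⟩ z hz
      exact even_of_mem_bv_evenBound hz)
  obtain ⟨s, hs, hFs, -⟩ := hF.exists_isState h𝒢 (χ := top) isSentence_top fun ⟨_, h⟩ => by
    refine hcons fun φ => ?_
    have h₁ : Derivable (doubleConst '' (evenBound '' T)) φ.doubleConst :=
      h.cons₁ fun e => by simp only [propEval_neg, propEval_top]; tauto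
    -- Halving undoes the doubling, so an inconsistency of the modified theory yields one of `T`.
    have h₂ := h₁.cmap (ρ := id) (g := fun k => .const (k / 2)) hinj (hconst fun k => k / 2)
    have h₃ : ∀ φ : Formula A 𝒢, φ.doubleConst.cmap id (fun k => .const (k / 2)) = φ := fun φ =>
      (cmap_cmap_eq_cmap (fun _ _ => rfl) (fun _ _ => rfl) fun k => by simp [Term.cmap]).trans
        φ.cmap_id
    rw [h₃, Set.image_image] at h₂
    simp only [h₃, Set.image_id'] at h₂
    refine h₂.of_forall_derivable ?_
    rintro - ⟨ψ, hψ, rfl⟩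
    exact .mp _ _ (.hyp _ hψ) (equiv_evenBound h𝒢ne ψ).1.weaken
  refine ⟨s, hs, fun φ hφ => hFs ⟨hsent φ (hT φ hφ), ?_⟩⟩
  have h₁ := (equiv_evenBound h𝒢ne φ).2.cmap hinj (hconst fun k => 2 * k)
  rw [Set.image_empty] at h₁
  exact .mp _ _ (.hyp _ ⟨_, ⟨φ, hφ, rfl⟩, rfl⟩) h₁.weaken

end PCK

namespace PCK

universe u

open Function Formula

variable {A : Type u} {𝒢 : Set (Set A)}

/-! ## Properties of states -/

/-- The sentences known in a state form a theory. -/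
theorem IsTheory.known {s : Set (Formula A 𝒢)} (hs : IsTheory s) (i : A) :
    IsTheory {φ | know i φ ∈ s} where
  isSentence h := isSentence_know.1 (hs.isSentence h)
  thm h h' := hs.thm (.rk i _ h) (isSentence_know.2 h')
  mp {φ ψ} h h' := by
    have h₁ := hs.isSentence h
    have h₂ := hs.isSentence h'
    simp only [isSentence_know, isSentence_imp] at h₁ h₂
    exact hs.mp h (hs.mp h' (hs.thm (.know_imp_know i φ ψ) (by simp [h₂])))
  omega {x φ} hφ h := by
    -- The Barcan axiom moves the quantifier inside `K_i`; it is what a domain common to all states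
    -- requires.
    refine hs.mp (hs.omega (x := x) (φ := know i φ) hφ fun t ht => h t ht)
      (hs.thm (.base (.fo3 x i φ)) (isSentence_imp.2 ⟨hφ, hφ⟩))
  infer {k θ X τ} hτ h := by
    -- One more level of nesting, with antecedent `⊤` and operator `K_i`, makes the rule applicable
    -- under `K_i`.
    have e : ∀ p, nested (update θ (k + 1) top) (update X (k + 1) (.know i)) (k + 1) p =
        top.imp (know i (nested θ X k p)) := fun p => by
      rw [nested, update_self, update_self, NestOp.app]
      rw [nested_congr (θ' := θ) (X' := X) (fun j hj => update_of_ne (by omega) _ _)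
        fun j hj => update_of_ne (by omega) _ _]
    have h₁ := hs.infer (k := k + 1) (θ := update θ (k + 1) top)
      (X := update X (k + 1) (.know i)) (τ := τ) (by rw [e]; simpa using hτ) fun p hp => by
        rw [e]
        have := hs.isSentence (h p hp)
        exact hs.cons₁ (h p hp) (by simpa using this) fun e => by simp only [propEval_imp]; tauto
    rw [e] at h₁
    exact hs.cons₁ h₁ hτ fun e => by simp only [propEval_imp, propEval_top]; tauto

namespace IsState

variable {s : Set (Formula A 𝒢)} {φ ψ : Formula A 𝒢}

theorem neg_mem_iff (hs : IsState s) (hφ : φ.IsSentence) : neg φ ∈ s ↔ φ ∉ s := by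
  refine ⟨fun h h' => hs.bot_notMem <| hs.cons₂ h h' isSentence_bot fun e => ?_,
    (hs.complete hφ).resolve_left⟩
  simp only [propEval_neg, propEval_bot]; tauto

theorem and_mem_iff (hs : IsState s) (hφ : φ.IsSentence) (hψ : ψ.IsSentence) :
    and φ ψ ∈ s ↔ φ ∈ s ∧ ψ ∈ s :=
  ⟨fun h => ⟨hs.cons₁ h hφ fun e => by simp only [propEval_and]; tauto,
    hs.cons₁ h hψ fun e => by simp only [propEval_and]; tauto⟩,
    fun h => hs.cons₂ h.1 h.2 (by simp [hφ, hψ]) fun e => by simp only [propEval_and]; tauto⟩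

theorem imp_mem_iff (hs : IsState s) (hφ : φ.IsSentence) (hψ : ψ.IsSentence) :
    φ.imp ψ ∈ s ↔ (φ ∈ s → ψ ∈ s) := by
  rw [imp, hs.neg_mem_iff (by simp [hφ, hψ]), hs.and_mem_iff hφ (by simp [hψ]),
    hs.neg_mem_iff hψ]
  tauto

theorem or_mem_iff (hs : IsState s) (hφ : φ.IsSentence) (hψ : ψ.IsSentence) :
    φ.or ψ ∈ s ↔ φ ∈ s ∨ ψ ∈ s := by
  rw [Formula.or, hs.neg_mem_iff (by simp [hφ, hψ]), hs.and_mem_iff (by simp [hφ]) (by simp [hψ]),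
    hs.neg_mem_iff hψ, hs.neg_mem_iff hφ]
  tauto

theorem mem_of_base (hs : IsState s) (h : BaseSchema (φ.imp ψ)) (hψ : ψ.IsSentence) (hφ : φ ∈ s) :
    ψ ∈ s :=
  hs.mp hφ (hs.thm (.base h) (by simp [hψ, hs.isSentence hφ]))

/-- The infinitary rules, without nesting. -/
theorem mem_of_premises (hs : IsState s) (i : A) (hφ : φ.IsSentence)
    (h : ∀ p ∈ φ.premises, p ∈ s) : φ ∈ s := by
  have h₁ : top.imp φ ∈ s := hs.infer (k := 0) (θ := fun _ => top) (X := fun _ => .know i)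
    (by simp [nested, hφ]) fun p hp =>
      hs.cons₁ (h p hp) (by simp [nested, hs.isSentence (h p hp)]) fun e => by
        simp only [nested, propEval_imp]; tauto
  exact hs.cons₁ h₁ hφ fun e => by simp only [propEval_imp, propEval_top]; tauto

theorem all_mem_iff (hs : IsState s) {x : ℕ} (hφ : (all x φ).IsSentence) :
    all x φ ∈ s ↔ ∀ t : Term, t.vars = ∅ → φ.subst x t ∈ s :=
  ⟨fun h t ht => hs.mem_of_base (.fo2 x φ t (freeFor_of_closed ht x φ)) (isSentence_subst hφ ht) h,
    hs.omega hφ⟩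

theorem every_mem_iff (hs : IsState s) (hφ : φ.IsSentence) {G : 𝒢} (hG : G.1.Nonempty) :
    every G φ ∈ s ↔ ∀ i ∈ G.1, know i φ ∈ s := by
  refine ⟨fun h i hi => hs.mem_of_base (.ae G i hi φ) hφ h, fun h => ?_⟩
  refine hs.mem_of_premises hG.some hφ ?_
  rintro - ⟨i, hi, rfl⟩
  exact h i hi

theorem common_mem_iff (hs : IsState s) (hφ : φ.IsSentence) {G : 𝒢} (hG : G.1.Nonempty) :
    common G φ ∈ s ↔ ∀ m, 1 ≤ m → everyPow G m φ ∈ s := by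
  refine ⟨fun h m hm => hs.mem_of_base (.ac G m hm φ) (isSentence_everyPow.2 hφ) h, fun h => ?_⟩
  refine hs.mem_of_premises hG.some hφ ?_
  rintro - ⟨m, hm, rfl⟩
  exact h m hm

theorem everyP_mem_iff (hs : IsState s) (hφ : φ.IsSentence) {G : 𝒢} (hG : G.1.Nonempty) (r : Q01) :
    everyP G r φ ∈ s ↔ ∀ i ∈ G.1, knowP i r φ ∈ s := by
  refine ⟨fun h i hi => hs.mem_of_base (.ape G r i hi φ) hφ h, fun h => ?_⟩
  refine hs.mem_of_premises hG.some hφ ?_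
  rintro - ⟨i, hi, rfl⟩
  exact h i hi

theorem commonP_mem_iff (hs : IsState s) (hφ : φ.IsSentence) {G : 𝒢} (hG : G.1.Nonempty)
    (r : Q01) : commonP G r φ ∈ s ↔ ∀ m, fPow G r m φ ∈ s := by
  refine ⟨fun h m => hs.mem_of_base (.apc G r m φ) (isSentence_fPow hφ m) h, fun h => ?_⟩
  refine hs.mem_of_premises hG.some hφ ?_
  rintro - ⟨m, rfl⟩
  exact h m

theorem prob_anti (hs : IsState s) {i : A} {q r : Q01} (h : q ≤ r) (hr : prob i r φ ∈ s) :
    prob i q φ ∈ s := by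
  rcases h.eq_or_lt with rfl | h
  · exact hr
  have hφ : φ.IsSentence := isSentence_prob.1 (hs.isSentence hr)
  by_contra hq
  rw [← hs.neg_mem_iff (isSentence_prob.2 hφ)] at hq
  have h₁ : probLe i q φ ∈ s := hs.mem_of_base (.p3 i q φ) hφ hq
  have h₂ : probLt i r φ ∈ s := hs.mem_of_base (.p2 i q r h φ) hφ h₁
  exact (hs.neg_mem_iff (φ := prob i r φ) hφ).1 h₂ hr

/-- The contrapositive of the Archimedean rule, whose premises have thresholds below `r`; for `r =
0` the hypothesis contradicts `P_{i,≥ 0} φ`. -/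
theorem exists_lt_of_prob_notMem (hs : IsState s) {i : A} {r : Q01} (hφ : φ.IsSentence)
    (h : prob i r φ ∉ s) : ∃ q < r, prob i q φ ∉ s := by
  by_contra! hc
  refine h ?_
  by_cases hr : 0 < r
  · refine hs.mem_of_premises i hφ ?_
    rintro - ⟨m, q, hm, hq, rfl⟩
    refine hc q (Subtype.coe_lt_coe.1 ?_)
    have hr' : (0 : ℚ) < r := hr
    have : 0 < (m : ℚ) := lt_of_lt_of_le (by positivity) hm
    rw [hq]
    exact sub_lt_self _ (by positivity)
  · obtain rfl : r = 0 := le_antisymm (not_lt.1 hr) r.2.1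
    exact hs.thm (.base (.p1 i φ)) hφ

theorem prob_of_know_imp (hs : IsState s) {i : A} {r : Q01} (h : know i (φ.imp ψ) ∈ s)
    (hr : prob i r φ ∈ s) : prob i r ψ ∈ s := by
  have h' := hs.isSentence h
  simp only [isSentence_know, isSentence_imp] at h'
  exact hs.mp hr (hs.mp h (hs.thm (.know_imp_prob i r φ ψ) (by simp [h'])))

theorem prob_one_of_know (hs : IsState s) {i : A} (h : know i φ ∈ s) : prob i 1 φ ∈ s := by
  have h' : φ.IsSentence := isSentence_know.1 (hs.isSentence h)
  exact hs.mp h (hs.thm (.schema _ (.con i φ)) (by simp [h']))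

/-- Disjointness turns `P_{i,≥ r} φ` into `P_{i,≥ r} ¬ψ`, which is `P_{i,≤ 1-r} ψ`; if `1 - r < t`,
this refutes `P_{i,≥ t} ψ`. -/
theorem add_le_one_of_disjoint (hs : IsState s) {i : A} {r t : Q01}
    (h : know i (neg (and φ ψ)) ∈ s) (hr : prob i r φ ∈ s) (ht : prob i t ψ ∈ s) :
    (r : ℚ) + t ≤ 1 := by
  have hφ : φ.IsSentence := isSentence_prob.1 (hs.isSentence hr)
  have hψ : ψ.IsSentence := isSentence_prob.1 (hs.isSentence ht)
  by_contra! hc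
  have h₁ : know i (φ.imp (neg ψ)) ∈ s := (hs.known i).cons₁ h (by simp [hφ, hψ]) fun e => by
    simp only [propEval_neg, propEval_imp, propEval_and]; tauto
  have h₂ : probLe i r.compl ψ ∈ s := by
    rw [probLe, Q01.compl_compl]
    exact hs.prob_of_know_imp h₁ hr
  have h₃ : r.compl < t := Subtype.coe_lt_coe.1 (by simp only [Q01.compl]; linarith)
  have h₄ : probLt i t ψ ∈ s := hs.mem_of_base (.p2 i _ t h₃ ψ) hψ h₂
  exact (hs.neg_mem_iff (φ := prob i t ψ) hψ).1 h₄ ht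

theorem prob_or_of_disjoint (hs : IsState s) {i : A} {r t q : Q01} (hq : (q : ℚ) = r + t)
    (h : know i (neg (and φ ψ)) ∈ s) (hr : prob i r φ ∈ s) (ht : prob i t ψ ∈ s) :
    prob i q (φ.or ψ) ∈ s := by
  have hφ : φ.IsSentence := isSentence_prob.1 (hs.isSentence hr)
  have hψ : ψ.IsSentence := isSentence_prob.1 (hs.isSentence ht)
  refine hs.mem_of_base (.p4 i r t q ?_ φ ψ) (by simp [hφ, hψ]) ?_
  · rw [← hq, min_eq_right q.2.2]
  · rw [hs.and_mem_iff (by simp [hφ, hψ]) (by simp [hφ, hψ]),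
      hs.and_mem_iff (by simp [hφ]) (by simp [hψ])]
    exact ⟨⟨hr, ht⟩, hs.prob_one_of_know h⟩

theorem prob_or_notMem (hs : IsState s) {i : A} {r t q : Q01} (hq : (q : ℚ) = r + t)
    (hφ : φ.IsSentence) (hψ : ψ.IsSentence) (hr : prob i r φ ∉ s) (ht : prob i t ψ ∉ s) :
    prob i q (φ.or ψ) ∉ s := by
  have h₁ : probLe i r φ ∈ s :=
    hs.mem_of_base (.p3 i r φ) hφ ((hs.neg_mem_iff (isSentence_prob.2 hφ)).2 hr)
  have h₂ : probLt i t ψ ∈ s := (hs.neg_mem_iff (isSentence_prob.2 hψ)).2 ht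
  have h₃ : probLt i q (φ.or ψ) ∈ s := hs.mem_of_base (.p5 i r t q hq φ ψ) (by simp [probLt, hφ, hψ])
    ((hs.and_mem_iff (by simp [probLe, hφ]) (by simp [probLt, hψ])).2 ⟨h₁, h₂⟩)
  exact (hs.neg_mem_iff (by simp [hφ, hψ])).1 h₃

end IsState

/-! ## The canonical model -/

variable (A 𝒢) in
/-- The states of the canonical model. -/
def CanonicalState : Type u := {s : Set (Formula A 𝒢) // IsState s}

namespace CanonicalState

/-- The canonical accessibility relation. -/
def acc (i : A) (s : CanonicalState A 𝒢) : Set (CanonicalState A 𝒢) :=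
  {t | ∀ φ, know i φ ∈ s.1 → φ ∈ t.1}

variable {φ ψ : Formula A 𝒢} {i : A} {s : CanonicalState A 𝒢}

/-- The known sentences form a theory, so if `φ` is not known, the Lindenbaum lemma over that theory
yields an accessible state containing `¬φ`. -/
theorem know_mem_iff [Countable A] (h𝒢 : 𝒢.Countable) (hφ : φ.IsSentence) :
    know i φ ∈ s.1 ↔ ∀ t ∈ acc i s, φ ∈ t.1 := by
  refine ⟨fun h t ht => ht φ h, fun h => ?_⟩
  by_contra hc
  have hF := s.2.known i
  obtain ⟨t, ht, hFt, hφt⟩ := hF.exists_isState h𝒢 (χ := neg φ) hφ fun h' =>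
    hc (hF.cons₁ h' hφ fun e => by simp only [propEval_neg]; tauto)
  exact (ht.neg_mem_iff hφ).1 hφt (h ⟨t, ht⟩ fun ψ hψ => hFt hψ)

/-- Without accessible states everything would be known, in particular `⊥` and its disjointness from
itself. CON then gives `⊥` probability `1` twice, so `1 + 1 ≤ 1`. -/
theorem acc_nonempty [Countable A] (h𝒢 : 𝒢.Countable) (i : A) (s : CanonicalState A 𝒢) :
    (acc i s).Nonempty := by
  by_contra hc
  have h₁ : know i bot ∈ s.1 := (know_mem_iff h𝒢 isSentence_bot).2 fun t ht => (hc ⟨t, ht⟩).elim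
  have h₂ : know i (neg (and bot bot)) ∈ s.1 :=
    (know_mem_iff h𝒢 (by simp)).2 fun t ht => (hc ⟨t, ht⟩).elim
  have h₃ := s.2.prob_one_of_know h₁
  have := s.2.add_le_one_of_disjoint h₂ h₃ h₃
  norm_num at this

/-- The event that a sentence holds, as a subset of the sample space. -/
def event (i : A) (s : CanonicalState A 𝒢) (φ : Formula A 𝒢) : Set (acc i s) := {t | φ ∈ t.1.1}

/-- The canonical probability of an event. -/
noncomputable def measure (i : A) (s : CanonicalState A 𝒢) (E : Set (acc i s)) : ℝ :=
  sSup {x | ∃ (φ : Formula A 𝒢) (r : Q01), φ.IsSentence ∧ E = event i s φ ∧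
    prob i r φ ∈ s.1 ∧ x = ((r : ℚ) : ℝ)}

/-- Inclusion on the accessible states is a known implication. Hence the canonical measure does not
depend on the sentence chosen to represent an event. -/
theorem prob_mem_of_event_subset [Countable A] (h𝒢 : 𝒢.Countable) (hφ : φ.IsSentence)
    (hψ : ψ.IsSentence) (h : event i s φ ⊆ event i s ψ) {r : Q01} (hr : prob i r φ ∈ s.1) :
    prob i r ψ ∈ s.1 := by
  refine s.2.prob_of_know_imp ((know_mem_iff h𝒢 (by simp [hφ, hψ])).2 fun t ht => ?_) hr
  exact (t.2.imp_mem_iff hφ hψ).2 fun h' => h (a := ⟨t, ht⟩) h'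

/-- If `P_{i,≥ r} φ` fails, the Archimedean rule gives a failing `q < r`, and `q` bounds all
thresholds in the supremum. -/
theorem le_measure_iff [Countable A] (h𝒢 : 𝒢.Countable) (hφ : φ.IsSentence) (r : Q01) :
    ((r : ℚ) : ℝ) ≤ measure i s (event i s φ) ↔ prob i r φ ∈ s.1 := by
  constructor
  · intro h
    by_contra hr
    obtain ⟨q, hqr, hq⟩ := s.2.exists_lt_of_prob_notMem hφ hr
    have hle : measure i s (event i s φ) ≤ ((q : ℚ) : ℝ) := by
      refine csSup_le ⟨_, φ, 0, hφ, rfl, s.2.thm (.base (.p1 i φ)) hφ, rfl⟩ ?_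
      rintro - ⟨ψ, t, hψ, e, ht, rfl⟩
      have ht' := prob_mem_of_event_subset h𝒢 hψ hφ e.ge ht
      have : t ≤ q := le_of_not_ge fun hqt => hq (s.2.prob_anti hqt ht')
      exact_mod_cast this
    have : (r : ℚ) ≤ q := by exact_mod_cast h.trans hle
    exact absurd hqr (not_lt.2 this)
  · intro h
    refine le_csSup ⟨1, ?_⟩ ⟨φ, r, hφ, rfl, h, rfl⟩
    rintro - ⟨ψ, t, -, -, -, rfl⟩
    exact_mod_cast t.2.2

theorem measure_nonneg [Countable A] (h𝒢 : 𝒢.Countable) (hφ : φ.IsSentence) :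
    0 ≤ measure i s (event i s φ) := by
  simpa using (le_measure_iff h𝒢 hφ (0 : Q01)).2 (s.2.thm (.base (.p1 i φ)) hφ)

theorem measure_le_one (i : A) (s : CanonicalState A 𝒢) (E : Set (acc i s)) :
    measure i s E ≤ 1 := by
  refine Real.sSup_le ?_ zero_le_one
  rintro - ⟨ψ, t, -, -, -, rfl⟩
  exact_mod_cast t.2.2

theorem event_top : event i s (top : Formula A 𝒢) = Set.univ :=
  Set.eq_univ_of_forall fun t => t.1.2.taut isSentence_top fun e => by
    simp only [propEval_top]

theorem event_neg (hφ : φ.IsSentence) : event i s (neg φ) = (event i s φ)ᶜ :=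
  Set.ext fun t => t.1.2.neg_mem_iff hφ

theorem event_or (hφ : φ.IsSentence) (hψ : ψ.IsSentence) :
    event i s (φ.or ψ) = event i s φ ∪ event i s ψ :=
  Set.ext fun t => t.1.2.or_mem_iff hφ hψ

end CanonicalState

/-! ### Rational approximation and finite additivity -/

theorem Q01.exists_near_le {a ε : ℝ} (ha₀ : 0 ≤ a) (ha₁ : a ≤ 1) (hε : 0 < ε) :
    ∃ r : Q01, ((r : ℚ) : ℝ) ≤ a ∧ a - ε < ((r : ℚ) : ℝ) := by
  rcases ha₀.eq_or_lt with rfl | ha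
  · exact ⟨0, by simp, by simpa using hε⟩
  · obtain ⟨q, h₁, h₂⟩ := exists_rat_btwn (max_lt ha (sub_lt_self a hε))
    rw [max_lt_iff] at h₁
    exact ⟨⟨q, by exact_mod_cast h₁.1.le, by exact_mod_cast h₂.le.trans ha₁⟩, h₂.le, h₁.2⟩

theorem Q01.exists_near_gt {a ε : ℝ} (ha₀ : 0 ≤ a) (ha₁ : a < 1) (hε : 0 < ε) :
    ∃ r : Q01, a < ((r : ℚ) : ℝ) ∧ ((r : ℚ) : ℝ) < a + ε := by
  obtain ⟨q, h₁, h₂⟩ := exists_rat_btwn (lt_min ha₁ (lt_add_of_pos_right a hε))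
  rw [lt_min_iff] at h₂
  exact ⟨⟨q, by exact_mod_cast ha₀.trans h₁.le, by exact_mod_cast h₂.1.le⟩, h₁, h₂.2⟩

namespace CanonicalState

variable {φ ψ : Formula A 𝒢} {i : A} {s : CanonicalState A 𝒢}

/-- Thresholds slightly above both measures fail, hence so does their sum for the disjunction;
thresholds slightly below hold, hence by disjointness so does their sum. Half the supposed gap is
spent on each summand. -/
theorem measure_or [Countable A] (h𝒢 : 𝒢.Countable) (hφ : φ.IsSentence) (hψ : ψ.IsSentence)
    (h : event i s φ ∩ event i s ψ = ∅) :
    measure i s (event i s (φ.or ψ)) =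
      measure i s (event i s φ) + measure i s (event i s ψ) := by
  have hor : (φ.or ψ).IsSentence := by simp [hφ, hψ]
  have hk : know i (neg (and φ ψ)) ∈ s.1 :=
    (know_mem_iff h𝒢 (by simp [hφ, hψ])).2 fun t ht =>
      (t.2.neg_mem_iff (by simp [hφ, hψ])).2 fun h' => by
        rw [t.2.and_mem_iff hφ hψ] at h'
        exact Set.eq_empty_iff_forall_notMem.1 h ⟨t, ht⟩ h'
  have ha := measure_nonneg (i := i) (s := s) h𝒢 hφ
  have hb := measure_nonneg (i := i) (s := s) h𝒢 hψ
  have ha' := measure_le_one i s (event i s φ)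
  have hb' := measure_le_one i s (event i s ψ)
  have hc' := measure_le_one i s (event i s (φ.or ψ))
  have hA := le_measure_iff (i := i) (s := s) h𝒢 hφ
  have hB := le_measure_iff (i := i) (s := s) h𝒢 hψ
  have hC := le_measure_iff (i := i) (s := s) h𝒢 hor
  generalize measure i s (event i s φ) = a at *
  generalize measure i s (event i s ψ) = b at *
  generalize measure i s (event i s (φ.or ψ)) = c at *
  apply le_antisymm
  · by_contra! hlt
    obtain ⟨r, hr₁, hr₂⟩ := Q01.exists_near_gt ha (by linarith) (half_pos (sub_pos.2 hlt))
    obtain ⟨t, ht₁, ht₂⟩ := Q01.exists_near_gt hb (by linarith) (half_pos (sub_pos.2 hlt))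
    have hsum : (((r : ℚ) + t : ℚ) : ℝ) < c := by push_cast; linarith
    have hq : (r : ℚ) + t ≤ 1 := by exact_mod_cast (hsum.trans_le hc').le
    let q : Q01 := ⟨(r : ℚ) + t, add_nonneg r.2.1 t.2.1, hq⟩
    exact s.2.prob_or_notMem (q := q) rfl hφ hψ (fun h' => hr₁.not_ge ((hA r).2 h'))
      (fun h' => ht₁.not_ge ((hB t).2 h')) ((hC q).1 hsum.le)
  · by_contra! hlt
    obtain ⟨r, hr₁, hr₂⟩ := Q01.exists_near_le ha ha' (half_pos (sub_pos.2 hlt))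
    obtain ⟨t, ht₁, ht₂⟩ := Q01.exists_near_le hb hb' (half_pos (sub_pos.2 hlt))
    have hr := (hA r).1 hr₁
    have ht := (hB t).1 ht₁
    let q : Q01 := ⟨(r : ℚ) + t, add_nonneg r.2.1 t.2.1, s.2.add_le_one_of_disjoint hk hr ht⟩
    have := (hC q).2 (s.2.prob_or_of_disjoint rfl hk hr ht)
    simp only [q] at this
    push_cast at this
    linarith

/-- The canonical probability space of an agent in a state. -/
noncomputable def probSpace [Countable A] (h𝒢 : 𝒢.Countable) (i : A) (s : CanonicalState A 𝒢) :
    FinAddProbSpace (CanonicalState A 𝒢) where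
  sample := acc i s
  sample_nonempty := acc_nonempty h𝒢 i s
  events := {E | ∃ φ : Formula A 𝒢, φ.IsSentence ∧ E = event i s φ}
  isSetAlgebra :=
    { empty_mem := ⟨neg top, by simp, by rw [event_neg isSentence_top, event_top, Set.compl_univ]⟩
      compl_mem := by
        rintro - ⟨φ, hφ, rfl⟩
        exact ⟨neg φ, hφ, (event_neg hφ).symm⟩
      union_mem := by
        rintro - - ⟨φ, hφ, rfl⟩ ⟨ψ, hψ, rfl⟩
        exact ⟨φ.or ψ, by simp [hφ, hψ], (event_or hφ hψ).symm⟩ }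
  μ := measure i s
  μ_nonneg := by
    rintro - ⟨φ, hφ, rfl⟩
    exact measure_nonneg h𝒢 hφ
  μ_le_one E _ := measure_le_one i s E
  μ_univ := by
    refine le_antisymm (measure_le_one i s _) ?_
    have := (le_measure_iff (i := i) (s := s) h𝒢 isSentence_top (1 : Q01)).2
      (s.2.thm (.prob_one_of_thm i (.of_taut fun e => by simp only [propEval_top]))
        isSentence_top)
    rw [event_top] at this
    simpa using this
  μ_union := by
    rintro - ⟨φ, hφ, rfl⟩ - ⟨ψ, hψ, rfl⟩ h
    rw [← event_or hφ hψ]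
    exact measure_or h𝒢 hφ hψ h

end CanonicalState

/-- The canonical model. -/
noncomputable def canonicalModel [Countable A] (h𝒢 : 𝒢.Countable) (s₀ : CanonicalState A 𝒢) :
    Model A where
  S := CanonicalState A 𝒢
  S_nonempty := ⟨s₀⟩
  D := ULift.{u} {t : Term // t.vars = ∅}
  D_nonempty := ⟨⟨.const 0, Term.vars_const 0⟩⟩
  funI m k ts := ⟨.func m k fun j => (ts j).down.1, by
    simp only [Term.vars, Finset.eq_empty_iff_forall_notMem, Finset.mem_biUnion, not_exists, not_and]
    exact fun z j _ => Finset.eq_empty_iff_forall_notMem.1 (ts j).down.2 z⟩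
  relI s m k := {ts | rel m k (fun j => (ts j).down.1) ∈ s.1}
  K := CanonicalState.acc
  P := CanonicalState.probSpace h𝒢

/-! ### The truth lemma -/

section Truth

variable [Countable A] (h𝒢 : 𝒢.Countable) (s₀ : CanonicalState A 𝒢)

/-- The substitution that corresponds to a valuation in the canonical model. -/
def canonicalSubst (v : ℕ → (canonicalModel h𝒢 s₀).D) (x : ℕ) : Term :=
  (v x : ULift.{u} {t : Term // t.vars = ∅}).down.1

variable {h𝒢 s₀}

theorem vars_canonicalSubst (v : ℕ → (canonicalModel h𝒢 s₀).D) (x : ℕ) :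
    (canonicalSubst h𝒢 s₀ v x).vars = ∅ :=
  (v x : ULift.{u} {t : Term // t.vars = ∅}).down.2

theorem isSentence_msubst_canonicalSubst (v : ℕ → (canonicalModel h𝒢 s₀).D) (φ : Formula A 𝒢) :
    (φ.msubst (canonicalSubst h𝒢 s₀ v)).IsSentence :=
  isSentence_msubst (vars_canonicalSubst v) φ

theorem value_canonicalModel (v : ℕ → (canonicalModel h𝒢 s₀).D) (t : Term) :
    ((canonicalModel h𝒢 s₀).value v t : ULift.{u} {t : Term // t.vars = ∅}).down.1 =
      t.msubst (canonicalSubst h𝒢 s₀ v) := by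
  induction t with
  | var x => rfl
  | func m k ts ih => exact congrArg (Term.func m k) (funext ih)

variable (h𝒢 s₀) in
/-- Truth of a formula in the canonical model is membership of its closed instances. -/
def TruthIsMembership (φ : Formula A 𝒢) : Prop :=
  ∀ (s : CanonicalState A 𝒢) (v : ℕ → (canonicalModel h𝒢 s₀).D),
    (canonicalModel h𝒢 s₀).Sat φ s v ↔ φ.msubst (canonicalSubst h𝒢 s₀ v) ∈ s.1

namespace TruthIsMembership

variable {φ ψ : Formula A 𝒢}

theorem rel (m k : ℕ) (ts : Fin m → Term) :
    TruthIsMembership h𝒢 s₀ (.rel m k ts : Formula A 𝒢) := fun s v => by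
  have : (fun j => ((canonicalModel h𝒢 s₀).value v (ts j) :
      ULift.{u} {t : Term // t.vars = ∅}).down.1) =
      fun j => (ts j).msubst (canonicalSubst h𝒢 s₀ v) :=
    funext fun j => value_canonicalModel v (ts j)
  rw [msubst, ← this]
  rfl

theorem neg (hφ : TruthIsMembership h𝒢 s₀ φ) : TruthIsMembership h𝒢 s₀ (neg φ) := fun s v =>
  (not_congr (hφ s v)).trans (s.2.neg_mem_iff (isSentence_msubst_canonicalSubst v φ)).symm

theorem and (hφ : TruthIsMembership h𝒢 s₀ φ) (hψ : TruthIsMembership h𝒢 s₀ ψ) :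
    TruthIsMembership h𝒢 s₀ (and φ ψ) := fun s v =>
  (and_congr (hφ s v) (hψ s v)).trans (s.2.and_mem_iff (isSentence_msubst_canonicalSubst v φ)
    (isSentence_msubst_canonicalSubst v ψ)).symm

theorem all (x : ℕ) (hφ : TruthIsMembership h𝒢 s₀ φ) : TruthIsMembership h𝒢 s₀ (all x φ) :=
  fun s v => by
  have hg : Term.GroundOrFix (canonicalSubst h𝒢 s₀ v) := fun y => .inl (vars_canonicalSubst v y)
  have h₁ : ∀ t, (φ.msubst (update (canonicalSubst h𝒢 s₀ v) x (.var x))).subst x t =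
      φ.msubst (update (canonicalSubst h𝒢 s₀ v) x t) := fun t => by
    rw [subst_msubst (hg.update x) (update_self ..), update_idem]
  -- Changing the valuation at `x` amounts to substituting a closed term, so quantifying over the
  -- domain matches the ω-rule.
  have h₂ : ∀ (t : Term) (ht : t.vars = ∅), canonicalSubst h𝒢 s₀ (update v x ⟨t, ht⟩) =
      update (canonicalSubst h𝒢 s₀ v) x t := fun t ht =>
    comp_update (fun d : ULift.{u} {t : Term // t.vars = ∅} => d.down.1) v x ⟨t, ht⟩
  rw [msubst, s.2.all_mem_iff (isSentence_msubst_canonicalSubst v (.all x φ))]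
  simp only [h₁]
  constructor
  · intro h t ht
    rw [← h₂ t ht]
    exact (hφ _ _).1 (h ⟨t, ht⟩)
  · rintro h ⟨t, ht⟩
    refine (hφ _ _).2 ?_
    have := h t ht
    rwa [← h₂ t ht] at this

theorem know (i : A) (hφ : TruthIsMembership h𝒢 s₀ φ) : TruthIsMembership h𝒢 s₀ (know i φ) :=
  fun s v => by
  rw [msubst, CanonicalState.know_mem_iff h𝒢 (isSentence_msubst_canonicalSubst v φ)]
  exact forall₂_congr fun t _ => hφ t v

theorem every {G : 𝒢} (hG : G.1.Nonempty) (hφ : TruthIsMembership h𝒢 s₀ φ) :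
    TruthIsMembership h𝒢 s₀ (every G φ) := fun s v => by
  rw [msubst, s.2.every_mem_iff (isSentence_msubst_canonicalSubst v φ) hG]
  exact forall₂_congr fun i _ => hφ.know i s v

/-- This serves twice: for the probability clause and for the measurability of the model. -/
theorem setOf_sat (hφ : TruthIsMembership h𝒢 s₀ φ) (i : A) (s : CanonicalState A 𝒢)
    (v : ℕ → (canonicalModel h𝒢 s₀).D) :
    {t : CanonicalState.acc i s | (canonicalModel h𝒢 s₀).Sat φ t.1 v} =
      CanonicalState.event i s (φ.msubst (canonicalSubst h𝒢 s₀ v)) :=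
  Set.ext fun t => hφ t.1 v

theorem prob (i : A) (r : Q01) (hφ : TruthIsMembership h𝒢 s₀ φ) :
    TruthIsMembership h𝒢 s₀ (prob i r φ) := fun s v => by
  rw [msubst, ← CanonicalState.le_measure_iff h𝒢 (isSentence_msubst_canonicalSubst v φ),
    ← hφ.setOf_sat]
  rfl

theorem everyP {G : 𝒢} (hG : G.1.Nonempty) (r : Q01) (hφ : TruthIsMembership h𝒢 s₀ φ) :
    TruthIsMembership h𝒢 s₀ (everyP G r φ) := fun s v => by
  rw [msubst, s.2.everyP_mem_iff (isSentence_msubst_canonicalSubst v φ) hG]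
  exact forall₂_congr fun i _ => (hφ.prob i r).know i s v

theorem common {G : 𝒢} (hG : G.1.Nonempty) (hφ : TruthIsMembership h𝒢 s₀ φ) :
    TruthIsMembership h𝒢 s₀ (common G φ) := fun s v => by
  -- The iterates are not subformulas of `C_G φ`, so the claim is passed to them by a separate
  -- induction on the exponent.
  have h : ∀ m, TruthIsMembership h𝒢 s₀ (everyPow G m φ) := fun m => by
    induction m with
    | zero => exact hφ
    | succ m ih => exact ih.every hG
  refine ((canonicalModel h𝒢 s₀).sat_common_iff _ _ s v).trans ?_
  rw [msubst, s.2.common_mem_iff (isSentence_msubst_canonicalSubst v φ) hG]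
  refine forall₂_congr fun m _ => ?_
  rw [h m s v, msubst_everyPow]

theorem commonP {G : 𝒢} (hG : G.1.Nonempty) (r : Q01) (hφ : TruthIsMembership h𝒢 s₀ φ) :
    TruthIsMembership h𝒢 s₀ (commonP G r φ) := fun s v => by
  have h : ∀ m, TruthIsMembership h𝒢 s₀ (fPow G r m φ) := fun m => by
    induction m with
    | zero => exact (((TruthIsMembership.rel _ _ _).and (TruthIsMembership.rel _ _ _).neg).neg)
    | succ m ih => exact (hφ.and ih).everyP hG r
  refine ((canonicalModel h𝒢 s₀).sat_commonP_iff _ _ _ s v).trans ?_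
  rw [msubst, s.2.commonP_mem_iff (isSentence_msubst_canonicalSubst v φ) hG]
  refine forall_congr' fun m => ?_
  rw [h m s v, msubst_fPow]

end TruthIsMembership

/-- The truth lemma. -/
theorem truthIsMembership (h𝒢ne : ∀ G ∈ 𝒢, G.Nonempty) (φ : Formula A 𝒢) :
    TruthIsMembership h𝒢 s₀ φ := by
  induction φ with
  | rel m k ts => exact .rel m k ts
  | neg φ ih => exact ih.neg
  | and φ ψ ih₁ ih₂ => exact ih₁.and ih₂
  | all x φ ih => exact ih.all x
  | know i φ ih => exact ih.know i
  | every G φ ih => exact ih.every (h𝒢ne _ G.2)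
  | common G φ ih => exact ih.common (h𝒢ne _ G.2)
  | prob i r φ ih => exact ih.prob i r
  | everyP G r φ ih => exact ih.everyP (h𝒢ne _ G.2) r
  | commonP G r φ ih => exact ih.commonP (h𝒢ne _ G.2) r

end Truth

/-! ## Reducts -/

/-- The model in which the `k`-th constant is interpreted as the `2 k`-th constant of `M`. -/
def Model.halveConst (M : Model A) : Model A :=
  { M with funI := fun m k ds => if m = 0 then M.funI 0 (2 * k) Fin.elim0 else M.funI m k ds }

theorem Model.value_halveConst (M : Model A) (v : ℕ → M.D) (t : Term) :
    M.halveConst.value v t = M.value v (t.cmap id fun k => .const (2 * k)) := by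
  induction t with
  | var x => rfl
  | func m k ts ih =>
    by_cases e : m = 0
    · subst e
      simp only [Term.cmap, if_true, Model.value]
      exact congrArg (M.funI 0 (2 * k)) (funext fun j => j.elim0)
    · simp only [Term.cmap, Model.value, e, if_false, Model.halveConst]
      exact congrArg (M.funI m k) (funext ih)

/-- Only the constants are reinterpreted. Comparing events rather than single states makes each
modal clause a congruence. -/
theorem Model.setOf_sat_halveConst (M : Model A) (φ : Formula A 𝒢) (v : ℕ → M.D) :
    {s : M.S | M.halveConst.Sat φ s v} = {s | M.Sat φ.doubleConst s v} := by
  induction φ generalizing v with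
  | rel m k ts =>
    have : (fun j => M.halveConst.value v (ts j)) =
        fun j => M.value v ((ts j).cmap id fun k => .const (2 * k)) :=
      funext fun j => M.value_halveConst v (ts j)
    ext s
    exact iff_of_eq (congrArg (· ∈ M.relI s m k) this)
  | neg φ ih => exact congrArg (·ᶜ) (ih v)
  | and φ ψ ih₁ ih₂ => exact congrArg₂ (· ∩ ·) (ih₁ v) (ih₂ v)
  | all x φ ih =>
    ext s
    exact forall_congr' fun d => Set.ext_iff.1 (ih (update v x d)) s
  | know i φ ih => exact congrArg (M.knowSet i) (ih v)
  | every G φ ih => exact congrArg (M.everySet G.1) (ih v)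
  | common G φ ih =>
    exact congrArg (fun E => {s | ∀ m : ℕ, 1 ≤ m → s ∈ (M.everySet G.1)^[m] E}) (ih v)
  | prob i r φ ih => exact congrArg (M.probSet i r) (ih v)
  | everyP G r φ ih => exact congrArg (M.everyPSet G.1 r) (ih v)
  | commonP G r φ ih =>
    have h : ∀ (E : Set M.S) m, M.halveConst.fSet G.1 r E m = M.fSet G.1 r E m := fun E m => by
      induction m with
      | zero => rfl
      | succ m ih => exact congrArg (fun E' => M.everyPSet G.1 r (E ∩ E')) ih
    ext s
    refine forall_congr' fun m => ?_
    exact Set.ext_iff.1 ((h _ m).trans (congrArg (fun E => M.fSet G.1 r E m) (ih v))) s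

end PCK

/-- Every consistent theory is satisfiable in a measurable model with the consistency condition. -/
theorem theorem6 {A : Type*} [Countable A] (𝒢 : Set (Set A)) (h𝒢 : 𝒢.Countable)
    (h𝒢ne : ∀ G ∈ 𝒢, G.Nonempty) (T : Set (PCK.Formula A 𝒢))
    (hT : ∀ φ ∈ T, φ.IsSentence) (hcons : PCK.Consistent T) :
    ∃ M : PCK.Model A, M.IsMeasurable 𝒢 ∧ M.SatisfiesCon ∧
      ∃ s : M.S, ∀ φ ∈ T, M.SatAt s φ := by
  obtain ⟨s, hs, hTs⟩ := hcons.exists_isState h𝒢 h𝒢ne hT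
  let s₀ : PCK.CanonicalState A 𝒢 := ⟨s, hs⟩
  let M := PCK.canonicalModel h𝒢 s₀
  -- The consistency condition is reflexivity, as the sample space is the set of accessible states
  -- itself.
  refine ⟨M.halveConst, fun φ v s i => ?_, fun i s => subset_rfl, s₀, fun φ hφ v => ?_⟩
  · refine ⟨φ.doubleConst.msubst (PCK.canonicalSubst h𝒢 s₀ v),
      PCK.isSentence_msubst_canonicalSubst v _, ?_⟩
    exact (congrArg (fun E : Set M.S => {t : PCK.CanonicalState.acc i s | t.1 ∈ E})
      (M.setOf_sat_halveConst φ v)).trans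
      ((PCK.truthIsMembership h𝒢ne φ.doubleConst).setOf_sat i s v)
  · refine (Set.ext_iff.1 (M.setOf_sat_halveConst φ v) s₀).2 ?_
    refine (PCK.truthIsMembership h𝒢ne φ.doubleConst s₀ v).2 ?_
    have h := hTs φ hφ
    -- A sentence has no free variables for the valuation to act on.
    rw [PCK.Formula.msubst_eq_self fun x hx => ?_]
    · exact h
    · simp [show φ.doubleConst.fv = ∅ from hs.isSentence h] at hx
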